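/- Let $p$ be a prime, let $d\ge 1$, and let $G$ be a topological group isomorphic to $\mathbb{Z}_p^d$. Let $\mathbb{Z}_p[[G]]=\varprojlim_U \mathbb{Z}_p[G/U]$, where $U$ runs through the open subgroups of $G$, be its completed group algebra. Let $M$ be a $\mathbb{Z}_p[[G]]$-module which is finitely generated or, more generally, profinite (that is, $M$ carries a compact, Hausdorff, totally disconnected topology making it a topological $\mathbb{Z}_p[[G]]$-module). For an open subgroup $U$ of $G$ let $M_U$ be the largest quotient of $M$ on which $U$ acts trivially. Suppose that $M$ is systematically coinvariant-finite, i.e. $M_U$ is finite for every open subgroup $U$ of $G$. For open subgroups $V\subseteq U$ let $N_{U/V}\colon M_U\to M_V$ be the norm map, sending the class of $m$ to the class of $\sum_{\tau\in U/V}\tau m$, and let $\varinjlim_U M_U$ be the direct limit along these maps, a discrete torsion $\mathbb{Z}_p[[G]]$-module. Write $(-)^\vee=\mathrm{Hom}(-,\mathbb{Q}/\mathbb{Z})$ for the Pontryagin dual of such a module, with $G$-action $(gf)(x)=f(g^{-1}x)$; and write $M^\iota$ for $M$ with $\mathbb{Z}_p[[G]]$ acting through the involution of $\mathbb{Z}_p[[G]]$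 induced by $g\mapsto g^{-1}$, so that $g\cdot_\iota x=g^{-1}x$ for $g\in G$. Then there is a pseudo-isomorphism \[ M^\iota \longrightarrow \Big(\varinjlim_U M_U\Big)^\vee \] of $\mathbb{Z}_p[[G]]$-modules, i.e. a $\mathbb{Z}_p[[G]]$-homomorphism whose kernel and cokernel are pseudo-null, where a $\mathbb{Z}_p[[G]]$-module is called pseudo-null if it is finitely generated and its localization at every prime ideal of height at most $1$ is zero. -/

import Mathlib

noncomputable section

namespace Iwasawa

/-! ### The completed group algebra of a commutative topological group -/

section Algebra

variable (p : ℕ) [Fact p.Prime] (G : Type*) [CommGroup G] [TopologicalSpace G]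

/-- The projection `ℤ_p[G/V] → ℤ_p[G/U]` for open subgroups `V ≤ U` of `G`. -/
def groupRingProj {U V : OpenSubgroup G} (h : V ≤ U) :
    MonoidAlgebra ℤ_[p] (G ⧸ (V : Subgroup G)) →+* MonoidAlgebra ℤ_[p] (G ⧸ (U : Subgroup G)) :=
  MonoidAlgebra.mapDomainRingHom ℤ_[p]
    (QuotientGroup.map (V : Subgroup G) (U : Subgroup G) (MonoidHom.id G) (fun _ hx => h hx))

/-- The inverse limit of the group rings `ℤ_p[G/U]`, `U` running through the open subgroups of
`G`, as the subring of compatible families of the product. -/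
def completedGroupSubring :
    Subring (∀ U : OpenSubgroup G, MonoidAlgebra ℤ_[p] (G ⧸ (U : Subgroup G))) where
  carrier := {x | ∀ (U V : OpenSubgroup G) (h : V ≤ U), groupRingProj p G h (x V) = x U}
  mul_mem' hx hy U V h := by simp only [Pi.mul_apply, map_mul, hx U V h, hy U V h]
  one_mem' U V h := by simp only [Pi.one_apply, map_one]
  add_mem' hx hy U V h := by simp only [Pi.add_apply, map_add, hx U V h, hy U V h]
  zero_mem' U V h := by simp only [Pi.zero_apply, map_zero]
  neg_mem' hx U V h := by simp only [Pi.neg_apply, map_neg, hx U V h]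

/-- The completed group algebra `ℤ_p⟦G⟧ = lim_U ℤ_p[G/U]`. -/
abbrev CompletedGroupAlgebra : Type _ := completedGroupSubring p G

/-- The inverse limit topology on `ℤ_p⟦G⟧`, each `ℤ_p[G/U]` (a free `ℤ_p`-module on `G/U`)
carrying the topology of coordinatewise `p`-adic convergence. -/
instance : TopologicalSpace (CompletedGroupAlgebra p G) :=
  TopologicalSpace.induced
    (fun (x : CompletedGroupAlgebra p G) (U : OpenSubgroup G) (g : G ⧸ (U : Subgroup G)) =>
      (x.1 U).coeff g)
    inferInstance

/-- The group element `g`, viewed in `ℤ_p⟦G⟧`. -/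
def groupElt : G →* CompletedGroupAlgebra p G where
  toFun g := ⟨fun _ => MonoidAlgebra.single (g : G ⧸ _) 1, fun U V h => by
    simp [groupRingProj]
    rfl⟩
  map_one' := rfl
  map_mul' a b := Subtype.ext <| funext fun U => by
    change (MonoidAlgebra.single ((a * b : G) : G ⧸ (U : Subgroup G)) (1 : ℤ_[p])) =
      MonoidAlgebra.single (a : G ⧸ (U : Subgroup G)) 1 * MonoidAlgebra.single (b : G ⧸ _) 1
    simp [MonoidAlgebra.single_mul_single]

/-- The ring involution `ι` of `ℤ_p⟦G⟧` induced by `g ↦ g⁻¹` on each `G/U`. -/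
def involution : CompletedGroupAlgebra p G →+* CompletedGroupAlgebra p G where
  toFun x := ⟨fun U => MonoidAlgebra.mapDomainRingHom ℤ_[p]
      (invMonoidHom : (G ⧸ (U : Subgroup G)) →* _) (x.1 U), fun U V h => by
    have hx := x.2 U V h
    simp only [← hx]
    simp only [groupRingProj, ← RingHom.comp_apply, ← MonoidAlgebra.mapDomainRingHom_comp]
    congr 2
    ext a
    simp⟩
  map_one' := Subtype.ext <| funext fun U => map_one _
  map_mul' x y := Subtype.ext <| funext fun U => map_mul _ _ _
  map_zero' := Subtype.ext <| funext fun U => map_zero _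
  map_add' x y := Subtype.ext <| funext fun U => map_add _ _ _

theorem involution_groupElt (g : G) :
    involution p G (groupElt p G g) = groupElt p G g⁻¹ :=
  Subtype.ext <| funext fun U => by
    change MonoidAlgebra.mapDomainRingHom ℤ_[p] _ (MonoidAlgebra.single _ _) =
      MonoidAlgebra.single _ _
    simp

end Algebra

/-! ### Twist by the involution, and the Pontryagin dual -/

section Twist

variable (p : ℕ) [Fact p.Prime] (G : Type*) [CommGroup G] [TopologicalSpace G]
variable (M : Type*) [AddCommGroup M] [Module (CompletedGroupAlgebra p G) M]

/-- `M^ι`: the same underlying group as `M`, with `ℤ_p⟦G⟧` acting through the involution, so that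
`g ∈ G` acts as `g⁻¹` does on `M`. -/
def Twist (_p : ℕ) (_G : Type*) (M : Type*) : Type _ := M

instance (p : ℕ) (G : Type*) (M : Type*) [AddCommGroup M] : AddCommGroup (Twist p G M) :=
  inferInstanceAs (AddCommGroup M)

instance : Module (CompletedGroupAlgebra p G) (Twist p G M) :=
  Module.compHom M (involution p G)

/-- The identity map `M → M^ι`. -/
def toTwist : M ≃+ Twist p G M := AddEquiv.refl M

theorem smul_toTwist (x : CompletedGroupAlgebra p G) (m : M) :
    x • toTwist p G M m = toTwist p G M (involution p G x • m) := rfl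

theorem groupElt_smul_toTwist (g : G) (m : M) :
    groupElt p G g • toTwist p G M m = toTwist p G M (groupElt p G g⁻¹ • m) := by
  rw [smul_toTwist, involution_groupElt]

/-- The Pontryagin dual `Hom(D, ℚ/ℤ)` of a discrete torsion `ℤ_p⟦G⟧`-module `D`, with the
contragredient action `(g • f) x = f (g⁻¹ • x)`. -/
abbrev PontryaginDual (D : Type*) [AddCommGroup D] : Type _ := Twist p G (CharacterModule D)

theorem groupElt_smul_dual_apply (g : G) (f : CharacterModule M) (m : M) :
    (toTwist p G _).symm (groupElt p G g • toTwist p G (CharacterModule M) f) m =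
      f (groupElt p G g⁻¹ • m) := by
  rw [groupElt_smul_toTwist]
  rfl

end Twist

/-! ### Coinvariants and norm maps -/

section Coinvariants

variable (p : ℕ) [Fact p.Prime] {G : Type*} [CommGroup G] [TopologicalSpace G]
variable (M : Type*) [AddCommGroup M] [Module (CompletedGroupAlgebra p G) M]

/-- The submodule of `M` generated by all `u • m - m` with `u ∈ U`, `m ∈ M`. -/
def coinvariantsKer (U : OpenSubgroup G) : Submodule (CompletedGroupAlgebra p G) M :=
  Submodule.span _ {x | ∃ u ∈ U, ∃ m : M, x = groupElt p G u • m - m}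

/-- `M_U`, the largest quotient of `M` on which `U` acts trivially. -/
abbrev Coinvariants (U : OpenSubgroup G) : Type _ := M ⧸ coinvariantsKer p M U

/-- `M` is systematically coinvariant-finite: `M_U` is finite for every open subgroup `U`. -/
def SystematicallyCoinvariantFinite : Prop :=
  ∀ U : OpenSubgroup G, Finite (Coinvariants p M U)

variable {M} in
theorem groupElt_smul_mk (U : OpenSubgroup G) {u : G} (hu : u ∈ U) (m : M) :
    groupElt p G u • (coinvariantsKer p M U).mkQ m = (coinvariantsKer p M U).mkQ m := by
  rw [← map_smul, ← sub_eq_zero, ← map_sub]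
  exact (Submodule.Quotient.mk_eq_zero _).2 (Submodule.subset_span ⟨u, hu, m, rfl⟩)

/-- The action of `G/V` on `M_V`. -/
def quotientAction (V : OpenSubgroup G) :
    G ⧸ (V : Subgroup G) →* Module.End (CompletedGroupAlgebra p G) (Coinvariants p M V) :=
  QuotientGroup.lift (V : Subgroup G)
    ((algebraMap (CompletedGroupAlgebra p G)
      (Module.End (CompletedGroupAlgebra p G) (Coinvariants p M V))).toMonoidHom.comp
        (groupElt p G))
    (fun v hv => by
      ext m
      exact groupElt_smul_mk p V hv m)

/-- `U/V`, as a subgroup of `G/V`. -/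
abbrev relQuotient (U V : OpenSubgroup G) : Subgroup (G ⧸ (V : Subgroup G)) :=
  (U : Subgroup G).map (QuotientGroup.mk' (V : Subgroup G))

variable [IsTopologicalGroup G] [CompactSpace G]

/-- The norm endomorphism `m ↦ ∑_{τ ∈ U/V} τ • m` of `M_V` (a finite sum). -/
def normEnd (U V : OpenSubgroup G) :
    Module.End (CompletedGroupAlgebra p G) (Coinvariants p M V) :=
  ∑ᶠ τ : relQuotient U V, quotientAction p M V τ

theorem normEnd_mul_quotientAction (U V : OpenSubgroup G) (u : G) (hu : u ∈ U) :
    normEnd p M U V * quotientAction p M V (u : G ⧸ (V : Subgroup G)) = normEnd p M U V := by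
  have : Finite (G ⧸ (V : Subgroup G)) := Subgroup.quotient_finite_of_isOpen _ V.isOpen
  let t : relQuotient U V := ⟨(u : G ⧸ (V : Subgroup G)), u, hu, rfl⟩
  have : Fintype (relQuotient U V) := Fintype.ofFinite _
  rw [normEnd, finsum_eq_sum_of_fintype, Finset.sum_mul]
  simp_rw [← map_mul]
  exact Fintype.sum_equiv (Equiv.mulRight t) _ _ fun τ => rfl

/-- The norm map `N_{U/V} : M_U → M_V`, for open subgroups `V ≤ U`, sending the class of `m` to
`∑_{τ ∈ U/V} τ • m`. -/
def normMap (U V : OpenSubgroup G) :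
    Coinvariants p M U →ₗ[CompletedGroupAlgebra p G] Coinvariants p M V :=
  (coinvariantsKer p M U).liftQ (normEnd p M U V ∘ₗ (coinvariantsKer p M V).mkQ) <| by
    refine Submodule.span_le.2 ?_
    rintro _ ⟨u, hu, m, rfl⟩
    have h := LinearMap.congr_fun (normEnd_mul_quotientAction p M U V u hu)
      ((coinvariantsKer p M V).mkQ m)
    simp only [SetLike.mem_coe, LinearMap.mem_ker, map_sub, sub_eq_zero]
    exact h

open Classical in
/-- The direct limit of the `M_U` along the norm maps, over the open subgroups `U` of `G` ordered
by reverse inclusion. -/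
abbrev CoinvariantsLimit : Type _ :=
  Module.DirectLimit (R := CompletedGroupAlgebra p G)
    (fun U : (OpenSubgroup G)ᵒᵈ => Coinvariants p M (OrderDual.ofDual U))
    (fun U V _ => normMap p M (OrderDual.ofDual U) (OrderDual.ofDual V))

end Coinvariants

/-! ### Pseudo-isomorphisms -/

section Pseudo

variable {A : Type*} [CommRing A]

/-- A module over `A` is pseudo-null if it is finitely generated and its localization at every
prime ideal of height at most one vanishes. -/
def IsPseudoNull (A : Type*) [CommRing A] (M : Type*) [AddCommGroup M] [Module A M] : Prop :=
  Module.Finite A M ∧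
    ∀ (P : Ideal A) [P.IsPrime], P.height ≤ 1 → Subsingleton (LocalizedModule P.primeCompl M)

/-- A pseudo-isomorphism is a homomorphism with pseudo-null kernel and cokernel. -/
def IsPseudoIso {M N : Type*} [AddCommGroup M] [Module A M] [AddCommGroup N] [Module A N]
    (f : M →ₗ[A] N) : Prop :=
  IsPseudoNull A (LinearMap.ker f) ∧ IsPseudoNull A (N ⧸ LinearMap.range f)

end Pseudo

/-- `M` is a profinite `ℤ_p⟦G⟧`-module for a suitable topology: compact, Hausdorff, totally
disconnected, with continuous addition and scalar multiplication. -/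
def IsProfiniteModule (p : ℕ) [Fact p.Prime] (G : Type*) [CommGroup G] [TopologicalSpace G]
    (M : Type*) [AddCommGroup M] [Module (CompletedGroupAlgebra p G) M] : Prop :=
  ∃ _ : TopologicalSpace M, IsTopologicalAddGroup M ∧ CompactSpace M ∧ T2Space M ∧
    TotallyDisconnectedSpace M ∧ ContinuousSMul (CompletedGroupAlgebra p G) M

end Iwasawa

end

/-! Write A for ℤ_p⟦G⟧. The dual of the limit of the M_U is identified with Hom(M, A/s) for a
well-chosen s in the annihilator of M, and M is then compared with Hom(M, A/s) by commutative
algebra over the Noetherian normal domain A.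

Structure of A. Sending X_i to g_i - 1, for topological generators g_i, identifies ℤ_p⟦X_1, …, X_d⟧
with A (`nonempty_powerSeries_equiv`). Hence A is a Noetherian domain, and it is normal because
complete integral closedness passes to power series rings. A profinite M with finite coinvariants is
finitely generated by topological Nakayama (`IsProfiniteModule.finite`).

Choice of s. Cayley–Hamilton produces, for each U, an annihilator of M whose image in ℤ_p[G/U] is a
power of p. By Baire's theorem in the compact annihilator, a single s has nonzero norm at all of the
countably many levels, so that t_U s_U = p^(n_U) for suitable t_U and n_U
(`exists_annihilator_forall_dvd_pow`).

Duality. The character χ_U(x) = c_1(t_U x_U) / p^(n_U), where c_1 is the coefficient at 1, is the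
class of c_1(x/s) modulo ℤ_p. It depends only on s, kills sA, induces a perfect pairing on
ℤ_p[G/U]/s_U and satisfies χ_V(N_{U/V} x) = χ_U(x). Thus h ↦ (class of m in M_U ↦ χ_U(h(m))) is an
isomorphism from Hom(M, A/s) to the dual of the limit; compactness of A glues the finite levels
(`nonempty_hom_linearEquiv_character`).

Comparison. Inverting the nonzero elements outside all minimal primes of s turns A into a PID, over
which a finitely generated module killed by s is isomorphic to its dual into the quotient by s.
Clearing denominators gives an A-linear map M → Hom(M, A/s). It is an isomorphism at primes of
height at most 1: those containing s survive the localization, and at the others both modules vanish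
(`exists_hom_quotient_pseudoIso`). The involution twists source and target alike and permutes primes
of a given height, so it enters only at the end. -/

noncomputable section

namespace Iwasawa

/-! ### Homomorphisms from torsion modules over a principal ideal domain -/

/-- If `q` divides `a ≠ 0` in a domain, then `Hom(R/q, R/a)` is isomorphic to `R/q`. -/
theorem nonempty_quotient_equiv_hom {R : Type*} [CommRing R] [IsDomain R] {a q : R} (ha : a ≠ 0)
    (hq : q ∣ a) :
    Nonempty ((R ⧸ Ideal.span {q}) ≃ₗ[R] ((R ⧸ Ideal.span {q}) →ₗ[R] (R ⧸ Ideal.span {a}))) := by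
  obtain ⟨b, rfl⟩ := hq
  have hb : b ≠ 0 := right_ne_zero_of_mul ha
  -- Multiplication by b = a/q generates the Hom module, and its annihilator is exactly (q).
  let β : (R ⧸ Ideal.span {q}) →ₗ[R] (R ⧸ Ideal.span {q * b}) :=
    Submodule.mapQ _ _ (LinearMap.mulLeft R b) <| by
      rw [Ideal.span, Submodule.span_le]
      rintro _ rfl
      simp [mul_comm b]
  let F : R →ₗ[R] ((R ⧸ Ideal.span {q}) →ₗ[R] (R ⧸ Ideal.span {q * b})) :=
    LinearMap.toSpanSingleton R _ β
  have hF : ∀ r x, F r (Submodule.Quotient.mk x) = Submodule.Quotient.mk (r * (b * x)) :=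
    fun r x => rfl
  have hker : LinearMap.ker F = Ideal.span {q} := by
    ext r
    rw [LinearMap.mem_ker, Ideal.mem_span_singleton]
    constructor
    · intro h
      have h1 := LinearMap.congr_fun h (Submodule.Quotient.mk 1)
      rw [hF, LinearMap.zero_apply, Submodule.Quotient.mk_eq_zero, Ideal.mem_span_singleton,
        mul_one] at h1
      exact (mul_dvd_mul_iff_right hb).1 h1
    · rintro ⟨c, rfl⟩
      refine LinearMap.ext fun x => ?_
      obtain ⟨x, rfl⟩ := Submodule.Quotient.mk_surjective _ x
      rw [hF, LinearMap.zero_apply, Submodule.Quotient.mk_eq_zero, Ideal.mem_span_singleton]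
      exact ⟨c * x, by ring⟩
  have hsurj : Function.Surjective F := by
    intro h
    obtain ⟨y, hy⟩ := Submodule.Quotient.mk_surjective _ (h (Submodule.Quotient.mk 1))
    have h0 : Submodule.Quotient.mk (p := Ideal.span {q * b}) (q * y) = 0 := by
      have h1 : q • (Submodule.Quotient.mk 1 : R ⧸ Ideal.span {q}) = 0 := by
        rw [← Submodule.Quotient.mk_smul, smul_eq_mul, mul_one, Submodule.Quotient.mk_eq_zero]
        exact Ideal.mem_span_singleton_self q
      rw [← smul_eq_mul]
      exact (congrArg (q • ·) hy).trans (by rw [← map_smul, h1, map_zero])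
    rw [Submodule.Quotient.mk_eq_zero, Ideal.mem_span_singleton,
      mul_dvd_mul_iff_left (left_ne_zero_of_mul ha)] at h0
    obtain ⟨r, rfl⟩ := h0
    refine ⟨r, LinearMap.ext fun x => ?_⟩
    obtain ⟨x, rfl⟩ := Submodule.Quotient.mk_surjective _ x
    have hx : Submodule.Quotient.mk (p := Ideal.span {q}) x = x • Submodule.Quotient.mk 1 := by
      rw [← Submodule.Quotient.mk_smul, smul_eq_mul, mul_one]
    rw [hx, map_smul, map_smul, ← hy, hF, mul_one, mul_comm r]
  exact ⟨(Submodule.quotEquivOfEq _ _ hker.symm).trans (F.quotKerEquivOfSurjective hsurj)⟩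

/-- A finitely generated module over a PID which is killed by `a ≠ 0` is isomorphic to
its dual `Hom(-, R/a)`. -/
theorem nonempty_equiv_hom_quotient {R N : Type*} [CommRing R] [IsDomain R]
    [IsPrincipalIdealRing R] [AddCommGroup N] [Module R N] [Module.Finite R N] {a : R}
    (ha : a ≠ 0) (h : ∀ x : N, a • x = 0) :
    Nonempty (N ≃ₗ[R] (N →ₗ[R] (R ⧸ Ideal.span {a}))) := by
  classical
  have htors : Module.IsTorsion R N := fun x => ⟨⟨a, mem_nonZeroDivisors_of_ne_zero ha⟩, h x⟩
  obtain ⟨ι, _, q, -, e, ⟨E⟩⟩ := Module.equiv_directSum_of_isTorsion htors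
  let E' : N ≃ₗ[R] (∀ i, R ⧸ Ideal.span {q i ^ e i}) :=
    E.trans (DirectSum.linearEquivFunOnFintype R ι _)
  have hdvd : ∀ i, q i ^ e i ∣ a := by
    intro i
    have h1 : a • (Pi.single i (Submodule.Quotient.mk 1) :
        ∀ i, R ⧸ Ideal.span {q i ^ e i}) = 0 := by
      apply E'.symm.injective
      rw [map_smul, h, map_zero]
    have h2 := congr_fun h1 i
    rw [Pi.smul_apply, Pi.single_eq_same, ← Submodule.Quotient.mk_smul, smul_eq_mul, mul_one,
      Pi.zero_apply, Submodule.Quotient.mk_eq_zero, Ideal.mem_span_singleton] at h2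
    exact h2
  exact ⟨E'.trans <| (LinearEquiv.piCongrRight fun i =>
    (nonempty_quotient_equiv_hom ha (hdvd i)).some).trans <|
    (LinearMap.lsum R (fun i => R ⧸ Ideal.span {q i ^ e i}) R).trans <|
    LinearEquiv.congrLeft _ R E'.symm⟩

/-! ### Localization at finitely many primes of height one -/

/-- The elements of `A` lying in no minimal prime of `s`. -/
def minimalPrimesCompl {A : Type*} [CommRing A] (s : A) : Submonoid A :=
  -- The zero ideal is included so that 0 is excluded even when s is a unit and has no minimal
  -- primes.
  ⨅ P : {P : Ideal A // P ∈ (Ideal.span {s}).minimalPrimes ∨ (P = ⊥ ∧ P.IsPrime)},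
    @Ideal.primeCompl A _ P.1 (P.2.elim (fun h => h.1.1) fun h => h.2)

theorem mem_minimalPrimesCompl {A : Type*} [CommRing A] [IsDomain A] {s x : A} :
    x ∈ minimalPrimesCompl s ↔ x ≠ 0 ∧ ∀ P ∈ (Ideal.span {s}).minimalPrimes, x ∉ P := by
  simp only [minimalPrimesCompl, Submonoid.mem_iInf, Subtype.forall, Ideal.mem_primeCompl_iff]
  constructor
  · intro h
    exact ⟨fun hx => h ⊥ (Or.inr ⟨rfl, Ideal.isPrime_bot⟩) (by simp [hx]),
      fun P hP => h P (Or.inl hP)⟩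
  · rintro ⟨h0, h⟩ P (hP | ⟨rfl, -⟩)
    · exact h P hP
    · simpa using h0

theorem minimalPrimesCompl_le {A : Type*} [CommRing A] [IsDomain A] (s : A) :
    minimalPrimesCompl s ≤ nonZeroDivisors A :=
  fun _ hx => mem_nonZeroDivisors_of_ne_zero (mem_minimalPrimesCompl.1 hx).1

/-- A prime ideal of height at most one in a domain contains no other nonzero prime ideal. -/
theorem eq_of_le_of_height_le_one {A : Type*} [CommRing A] [IsDomain A] {P Q : Ideal A}
    [P.IsPrime] [Q.IsPrime] (hQ0 : Q ≠ ⊥) (hle : Q ≤ P) (hP : P.height ≤ 1) : Q = P := by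
  by_contra heq
  have : (⊥ : Ideal A).IsPrime := Ideal.isPrime_bot
  have h1 := Ideal.height_add_one_le_of_lt_of_isPrime (bot_lt_iff_ne_bot.2 hQ0)
  have h2 := Ideal.height_add_one_le_of_lt_of_isPrime (lt_of_le_of_ne hle heq)
  have h3 : (1 + 1 : ℕ∞) ≤ 1 :=
    (add_le_add_left (le_trans (self_le_add_left 1 _) h1) 1).trans (h2.trans hP)
  exact absurd h3 (by decide)

/-- A prime ideal disjoint from `minimalPrimesCompl s` is zero or a minimal prime of `s`. -/
theorem eq_bot_or_mem_minimalPrimes {A : Type*} [CommRing A] [IsDomain A] [IsNoetherianRing A]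
    {s : A} {Q : Ideal A} [Q.IsPrime]
    (hQ : Disjoint (minimalPrimesCompl s : Set A) (Q : Set A)) :
    Q = ⊥ ∨ Q ∈ (Ideal.span {s}).minimalPrimes := by
  classical
  have hfin := (Ideal.span {s}).finite_minimalPrimes_of_isNoetherianRing A
  let F : Finset (Ideal A) := insert ⊥ hfin.toFinset
  have hF : ∀ P ∈ F, P.IsPrime := by
    intro P hP
    rcases Finset.mem_insert.1 hP with rfl | hP
    · exact Ideal.isPrime_bot
    · exact ((hfin.mem_toFinset).1 hP).1.1
  have hsub : (Q : Set A) ⊆ ⋃ P ∈ (F : Set (Ideal A)), ((id P : Ideal A) : Set A) := by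
    intro x hx
    by_contra hcon
    simp only [Set.mem_iUnion, not_exists, F, Finset.coe_insert, Set.mem_insert_iff,
      Set.Finite.coe_toFinset, id] at hcon
    exact Set.disjoint_left.1 hQ (mem_minimalPrimesCompl.2
      ⟨fun h0 => hcon ⊥ (Or.inl rfl) (by simp [h0]), fun P hP => hcon P (Or.inr hP)⟩) hx
  -- Prime avoidance puts Q inside 0 or a single minimal prime of s. The latter has height at most 1
  -- by Krull's principal ideal theorem, so a nonzero Q equals it.
  obtain ⟨P, hP, hle⟩ := (Ideal.subset_union_prime (f := id) ⊥ ⊥ fun P hP _ _ => hF P hP).1 hsub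
  rcases Finset.mem_insert.1 hP with rfl | hP
  · exact Or.inl (le_bot_iff.1 hle)
  · rw [hfin.mem_toFinset] at hP
    have hPp : P.IsPrime := hP.1.1
    by_cases hQ0 : Q = ⊥
    · exact Or.inl hQ0
    right
    by_cases heq : Q = P
    · exact heq ▸ hP
    exfalso
    exact heq (eq_of_le_of_height_le_one hQ0 hle
      (Ideal.height_le_one_of_isPrincipal_of_mem_minimalPrimes _ P hP))

/-- The primes surviving in the localization are 0 and the minimal primes of s. They are finitely
many and the nonzero ones are maximal, so the localization is a Dedekind domain with finitely many
primes, hence a PID. -/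
theorem isPrincipalIdealRing_localization_minimalPrimesCompl {A : Type*} [CommRing A] [IsDomain A]
    [IsNoetherianRing A] [IsIntegrallyClosed A] (s : A) :
    IsPrincipalIdealRing (Localization (minimalPrimesCompl s)) := by
  set S := minimalPrimesCompl s
  let R := Localization S
  have hS := minimalPrimesCompl_le s
  have : IsDomain R := IsLocalization.isDomain_localization hS
  have hprime : ∀ Q : Ideal R, Q.IsPrime → Q.comap (algebraMap A R) = ⊥ ∨
      Q.comap (algebraMap A R) ∈ (Ideal.span {s}).minimalPrimes := by
    intro Q hQ
    have h := (IsLocalization.isPrime_iff_isPrime_disjoint S R Q).1 hQ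
    have := h.1
    exact eq_bot_or_mem_minimalPrimes h.2
  have hinj : Function.Injective (fun Q : Ideal R => Q.comap (algebraMap A R)) := by
    intro Q Q' h
    exact (IsLocalization.map_under S R Q).symm.trans
      ((congrArg (Ideal.map (algebraMap A R)) h).trans (IsLocalization.map_under S R Q'))
  have : IsNoetherianRing R := IsLocalization.isNoetherianRing S R inferInstance
  have : IsIntegrallyClosed R := isIntegrallyClosed_of_isLocalization R S hS
  have hne : ∀ Q : Ideal R, Q ≠ ⊥ → Q.comap (algebraMap A R) ≠ ⊥ := by
    intro Q hQ0 h
    refine hQ0 (hinj (h.trans ?_))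
    exact ((RingHom.injective_iff_ker_eq_bot _).1 (IsLocalization.injective R hS)).symm
  have : Ring.DimensionLEOne R := ⟨by
    intro Q hQ0 hQ
    have hQ1 : Q.comap (algebraMap A R) ∈ (Ideal.span {s}).minimalPrimes :=
      (hprime Q hQ).resolve_left (hne Q hQ0)
    obtain ⟨m, hm, hle⟩ := Q.exists_le_maximal hQ.ne_top
    have hm1 : m.comap (algebraMap A R) ∈ (Ideal.span {s}).minimalPrimes :=
      (hprime m hm.isPrime).resolve_left (hne m fun h => hQ0 (le_bot_iff.1 (h ▸ hle)))
    have : Q = m := hinj (le_antisymm (Ideal.comap_mono hle)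
      (hm1.2 hQ1.1 (Ideal.comap_mono hle)))
    exact this ▸ hm⟩
  have : IsDedekindDomain R := {}
  refine IsPrincipalIdealRing.of_finite_primes ?_
  have hfin := ((Ideal.span {s}).finite_minimalPrimes_of_isNoetherianRing A).insert ⊥
  exact Set.Finite.of_finite_image (f := fun Q : Ideal R => Q.comap (algebraMap A R))
    (hfin.subset (by rintro _ ⟨Q, hQ, rfl⟩; exact hprime Q hQ)) hinj.injOn

/-- A finitely generated module over a Noetherian normal domain killed by `s ≠ 0` maps to
`Hom(-, A/s)` with kernel and cokernel supported in codimension at least two. -/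
theorem exists_hom_quotient_pseudoIso {A M : Type*} [CommRing A] [IsDomain A]
    [IsNoetherianRing A] [IsIntegrallyClosed A] [AddCommGroup M] [Module A M] [Module.Finite A M]
    {s : A} (hs0 : s ≠ 0) (hs : ∀ m : M, s • m = 0) :
    ∃ f : M →ₗ[A] (M →ₗ[A] (A ⧸ Ideal.span {s})), ∀ P : Ideal A, P.IsPrime → P.height ≤ 1 →
      (∀ x, f x = 0 → ∃ t ∉ P, t • x = 0) ∧ ∀ y, ∃ t ∉ P, ∃ x, f x = t • y := by
  set S := minimalPrimesCompl s with hSdef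
  let R := Localization S
  have hS := minimalPrimesCompl_le s
  have : IsDomain R := IsLocalization.isDomain_localization hS
  have : IsPrincipalIdealRing R := isPrincipalIdealRing_localization_minimalPrimesCompl s
  have hfp : Module.FinitePresentation A M := Module.finitePresentation_of_finite A M
  let φ := LocalizedModule.mkLinearMap S M
  let I : Ideal A := Ideal.span {s}
  let ψ : (A ⧸ I) →ₗ[A] (R ⧸ Submodule.localized' R S (Algebra.linearMap A R) I) :=
    Submodule.toLocalizedQuotient' R S (Algebra.linearMap A R) I
  have hI : Submodule.localized' R S (Algebra.linearMap A R) I =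
      Ideal.span {algebraMap A R s} := by
    rw [show I = Submodule.span A {s} from rfl, Submodule.localized'_span]
    simp [Ideal.span]
  have hfin : Module.Finite R (LocalizedModule S M) := inferInstance
  have hkill : ∀ x : LocalizedModule S M, algebraMap A R s • x = 0 := by
    intro x
    rw [algebraMap_smul]
    induction x using LocalizedModule.induction_on with
    | h m t => rw [LocalizedModule.smul'_mk, hs, LocalizedModule.zero_mk]
  have hs0' : algebraMap A R s ≠ 0 := by
    rw [Ne, IsLocalization.to_map_eq_zero_iff R hS]
    exact hs0
  obtain ⟨e⟩ := nonempty_equiv_hom_quotient hs0' hkill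
  rw [← hI] at e
  let Φ := IsLocalizedModule.mapExtendScalars S φ ψ R
  -- Hom commutes with localization because M is finitely presented. So the isomorphism over R,
  -- which is not canonical, comes from a map f over A up to a denominator u.
  have hΦ : IsLocalizedModule S Φ := inferInstance
  obtain ⟨f, u, hf⟩ := Module.FinitePresentation.exists_lift_of_isLocalizedModule S Φ
    (e.toLinearMap.restrictScalars A ∘ₗ φ)
  have hf' : ∀ m, Φ (f m) = u • e (φ m) := fun m => LinearMap.congr_fun hf m
  -- A prime of height at most 1 containing s is a minimal prime of s, so every element of S is a
  -- unit there.
  have hSP : ∀ P : Ideal A, P.IsPrime → P.height ≤ 1 → s ∈ P → ∀ t : S, (t : A) ∉ P := by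
    intro P hP hP1 hsP t
    refine (mem_minimalPrimesCompl.1 t.2).2 P ?_
    obtain ⟨Q, hQ, hQP⟩ := Ideal.exists_minimalPrimes_le
      ((Ideal.span_singleton_le_iff_mem (I := P)).2 hsP)
    have hQp : Q.IsPrime := hQ.1.1
    have hQ0 : Q ≠ ⊥ := by
      rintro rfl
      exact hs0 (by simpa using hQ.1.2)
    exact eq_of_le_of_height_le_one hQ0 hQP hP1 ▸ hQ
  have hunit : ∀ x : LocalizedModule S M →ₗ[R] _, u • x = 0 → x = 0 := fun x hx =>
    ((Module.End.isUnit_iff _).1 (IsLocalizedModule.map_units Φ u)).1 (by rw [map_zero]; exact hx)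
  refine ⟨f, fun P hP hP1 => ?_⟩
  by_cases hsP : s ∈ P
  · refine ⟨fun x hx => ?_, fun y => ?_⟩
    · have h1 : φ x = 0 := by
        apply e.injective
        rw [map_zero]
        apply hunit
        rw [← hf', hx, map_zero]
      obtain ⟨t, ht⟩ := (IsLocalizedModule.eq_zero_iff S φ).1 h1
      exact ⟨t, hSP P hP hP1 hsP t, ht⟩
    · obtain ⟨⟨m, v⟩, hm⟩ := IsLocalizedModule.surj S φ (e.symm (Φ y))
      have h1 : Φ (f m) = Φ ((u * v) • y) := by
        rw [hf', ← hm]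
        have h2 : e ((v : A) • e.symm (Φ y)) = (v : A) • e (e.symm (Φ y)) :=
          (e.toLinearMap.restrictScalars A).map_smul _ _
        rw [e.apply_symm_apply] at h2
        exact (congrArg ((u : A) • ·) h2).trans
          ((smul_smul _ _ _).trans (Φ.map_smul ((u : A) * (v : A)) y).symm)
      obtain ⟨t, ht⟩ := IsLocalizedModule.exists_of_eq (S := S) (f := Φ) h1
      refine ⟨t * (u * v), ?_, t • m, ?_⟩
      · exact hSP P hP hP1 hsP (t * (u * v))
      · rw [Submonoid.smul_def, f.map_smul]
        exact ht.trans (smul_smul _ _ _)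
  -- Away from s nothing depends on f: s itself kills both M and the Hom module.
  · refine ⟨fun x _ => ⟨s, hsP, hs x⟩, fun y => ⟨s, hsP, 0, ?_⟩⟩
    rw [map_zero]
    ext m
    rw [LinearMap.smul_apply, ← map_smul, hs, map_zero, LinearMap.zero_apply]

end Iwasawa

end


noncomputable section

namespace Iwasawa

/-! ### Complete integral closedness of power series rings -/

/-- A domain is completely integrally closed when every almost integral fraction `g / h` lies in
it; this is phrased without fractions. -/
def IsCompletelyIntegrallyClosed (A : Type*) [CommRing A] : Prop :=
  ∀ g h c : A, h ≠ 0 → c ≠ 0 → (∀ n : ℕ, h ^ n ∣ c * g ^ n) → h ∣ g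

theorem IsCompletelyIntegrallyClosed.isIntegrallyClosed {A : Type*} [CommRing A] [IsDomain A]
    (hA : IsCompletelyIntegrallyClosed A) : IsIntegrallyClosed A := by
  refine (isIntegrallyClosed_iff (FractionRing A)).2 fun {x} hx => ?_
  obtain ⟨r, hr, hr'⟩ := hx.isAlmostIntegral
  obtain ⟨g, h, hh, rfl⟩ := IsFractionRing.div_surjective (A := A) x
  have hh0 : algebraMap A (FractionRing A) h ≠ 0 := by simpa using nonZeroDivisors.ne_zero hh
  obtain ⟨y, rfl⟩ : h ∣ g := by
    refine hA g h r (nonZeroDivisors.ne_zero hh) (nonZeroDivisors.ne_zero hr) fun n => ?_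
    obtain ⟨y, hy⟩ := hr' n
    refine ⟨y, IsFractionRing.injective A (FractionRing A) ?_⟩
    rw [map_mul, map_mul, map_pow, map_pow, hy, Algebra.smul_def, div_pow]
    field_simp
  exact ⟨y, by rw [map_mul]; field_simp⟩

theorem IsCompletelyIntegrallyClosed.of_ringEquiv {A B : Type*} [CommRing A] [CommRing B]
    (hA : IsCompletelyIntegrallyClosed A) (e : A ≃+* B) : IsCompletelyIntegrallyClosed B := by
  intro g h c hh hc H
  have := hA (e.symm g) (e.symm h) (e.symm c) (by simpa using hh) (by simpa using hc) fun n => by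
    simpa using map_dvd e.symm (H n)
  simpa using map_dvd e this

theorem isCompletelyIntegrallyClosed_of_valuationRing (A : Type*) [CommRing A] [IsDomain A]
    [WfDvdMonoid A] [ValuationRing A] : IsCompletelyIntegrallyClosed A := by
  intro g h c hh hc H
  rcases ValuationRing.dvd_total h g with hd | ⟨u, rfl⟩
  · exact hd
  have hg0 : g ≠ 0 := left_ne_zero_of_mul hh
  -- With h = g u, cancelling g^n leaves u^n ∣ c for all n, which is impossible for a nonunit u.
  have hu : IsUnit u := by
    by_contra hu
    obtain ⟨n, hn⟩ := FiniteMultiplicity.of_not_isUnit hu hc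
    refine hn ?_
    have := H (n + 1)
    rw [mul_pow, mul_comm] at this
    exact (mul_dvd_mul_iff_right (pow_ne_zero _ hg0)).1 this
  exact (hu.mul_right_dvd).2 dvd_rfl

-- Division term by term: complete integral closedness of A divides the constant terms, giving g = h
-- r + X g', and g' inherits the hypothesis with the same h and c. Iterating produces all
-- coefficients of the quotient.
open PowerSeries in
theorem IsCompletelyIntegrallyClosed.dvd_of_constantCoeff_ne_zero {A : Type*} [CommRing A]
    [IsDomain A] (hA : IsCompletelyIntegrallyClosed A) {g h c : PowerSeries A}
    (hh : constantCoeff h ≠ 0) (hc : constantCoeff c ≠ 0) (H : ∀ n : ℕ, h ^ n ∣ c * g ^ n) :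
    h ∣ g := by
  have key : ∀ g : PowerSeries A, (∀ n : ℕ, h ^ n ∣ c * g ^ n) →
      ∃ (r : A) (g' : PowerSeries A), (∀ n : ℕ, h ^ n ∣ c * g' ^ n) ∧ g = h * C r + X * g' := by
    intro g H
    obtain ⟨r, hr⟩ := hA (constantCoeff g) (constantCoeff h) (constantCoeff c) hh hc fun n => by
      simpa using map_dvd (constantCoeff (R := A)) (H n)
    obtain ⟨g', hg'⟩ := X_dvd_iff.2 (show constantCoeff (g - h * C r) = 0 by simp [hr])
    refine ⟨r, g', fun n => ?_, by rw [← hg']; ring⟩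
    -- X^n c g'^n = c (g - h r)^n, and each binomial term c g^i (h r)^(n-i) is divisible by h^n. The
    -- factor X^n can then be removed, since X is prime and does not divide h.
    have h1 : h ^ n ∣ X ^ n * (c * g' ^ n) := by
      have h2 : X ^ n * (c * g' ^ n) = c * (g + -(h * C r)) ^ n := by
        rw [← sub_eq_add_neg, hg']; ring
      rw [h2, add_pow, Finset.mul_sum]
      refine Finset.dvd_sum fun i hi => ?_
      rw [Finset.mem_range, Nat.lt_succ_iff] at hi
      have h3 : h ^ n ∣ (c * g ^ i) * (-(h * C r)) ^ (n - i) := by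
        rw [← Nat.add_sub_cancel' hi, pow_add, Nat.add_sub_cancel_left, neg_pow, mul_pow]
        exact mul_dvd_mul (H i) (Dvd.dvd.mul_left (dvd_mul_right _ _) _)
      rw [← mul_assoc, ← mul_assoc]
      exact Dvd.dvd.mul_right h3 _
    obtain ⟨q, hq⟩ := h1
    have h4 : (X : PowerSeries A) ^ n ∣ q := by
      refine (X_prime.pow_dvd_of_dvd_mul_left n ?_ (hq ▸ dvd_mul_right (X ^ n) _))
      rw [X_dvd_iff]
      rw [map_pow]; exact pow_ne_zero _ hh
    obtain ⟨q, rfl⟩ := h4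
    refine ⟨q, mul_left_cancel₀ (pow_ne_zero n X_ne_zero) ?_⟩
    rw [hq]; ring
  choose! r F hF hrF using key
  let G : ℕ → PowerSeries A := fun n => F^[n] g
  have hG : ∀ n, ∀ k : ℕ, h ^ k ∣ c * G n ^ k := by
    intro n
    induction n with
    | zero => exact H
    | succ n ih =>
      simp only [G, Function.iterate_succ_apply']
      exact hF _ ih
  have hstep : ∀ n, G n = h * C (r (G n)) + X * G (n + 1) := by
    intro n
    simp only [G, Function.iterate_succ_apply']
    exact hrF _ (hG n)
  -- `Q k` is the tail of the quotient starting at its k-th coefficient; `Q 0` is the quotient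
  -- itself.
  let Q : ℕ → PowerSeries A := fun k => mk fun n => r (G (n + k))
  have hQ : ∀ k, Q k = C (r (G k)) + X * Q (k + 1) := by
    intro k
    ext n
    cases n with
    | zero => simp [Q]
    | succ n => simp [Q, coeff_succ_X_mul, add_assoc, add_comm 1]
  have hdiff : ∀ n k, X ^ n ∣ G k - h * Q k := by
    intro n
    induction n with
    | zero => simp
    | succ n ih =>
      intro k
      have h1 : G k - h * Q k = X * (G (k + 1) - h * Q (k + 1)) := by
        rw [hstep k, hQ k]; ring
      rw [h1, pow_succ']
      exact mul_dvd_mul_left _ (ih _)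
  refine ⟨Q 0, sub_eq_zero.1 ?_⟩
  ext n
  exact X_pow_dvd_iff.1 (hdiff (n + 1) 0) n (Nat.lt_succ_self n)

-- Powers of X are split off from g, h and c. The X-orders satisfy k n ≤ j + l n for all n, which
-- forces k ≤ l, and the remaining factors have nonzero constant terms.
open PowerSeries in
theorem IsCompletelyIntegrallyClosed.powerSeries {A : Type*} [CommRing A] [IsDomain A]
    (hA : IsCompletelyIntegrallyClosed A) : IsCompletelyIntegrallyClosed (PowerSeries A) := by
  intro g h c hh hc H
  have key : ∀ f : PowerSeries A, f ≠ 0 → ∃ (k : ℕ) (f' : PowerSeries A),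
      constantCoeff f' ≠ 0 ∧ f = X ^ k * f' := by
    intro f hf
    exact ⟨_, f.divXPowOrder, by rwa [Ne, constantCoeff_divXPowOrder_eq_zero_iff],
      X_pow_order_mul_divXPowOrder.symm⟩
  by_cases hg : g = 0
  · simp [hg]
  obtain ⟨k, h, hh', rfl⟩ := key h hh
  obtain ⟨j, c, hc', rfl⟩ := key c hc
  obtain ⟨l, g, hg', rfl⟩ := key g hg
  have hX : ∀ (a b : ℕ) (u v : PowerSeries A), constantCoeff u ≠ 0 → constantCoeff v ≠ 0 →
      X ^ a * u ∣ X ^ b * v → a ≤ b ∧ u ∣ v := by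
    rintro a b u v hu hv ⟨w, hw⟩
    have hab : a ≤ b := by
      by_contra hlt
      obtain ⟨e, rfl⟩ := Nat.exists_eq_add_of_lt (not_le.1 hlt)
      refine hv (X_dvd_iff.1 ⟨X ^ e * u * w, mul_left_cancel₀ (pow_ne_zero b X_ne_zero) ?_⟩)
      rw [hw]; ring
    obtain ⟨e, rfl⟩ := Nat.exists_eq_add_of_le hab
    have h1 : u * w = X ^ e * v := by
      refine mul_left_cancel₀ (pow_ne_zero a X_ne_zero) ?_
      rw [← mul_assoc, ← hw]; ring
    obtain ⟨q, rfl⟩ := X_prime.pow_dvd_of_dvd_mul_left e (fun h => hu (X_dvd_iff.1 h))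
      (h1 ▸ dvd_mul_right (X ^ e) v)
    exact ⟨hab, q, mul_left_cancel₀ (pow_ne_zero e X_ne_zero) (by rw [← h1]; ring)⟩
  have H' : ∀ n, k * n ≤ j + l * n ∧ h ^ n ∣ c * g ^ n := by
    intro n
    refine hX _ _ _ _ (by rw [map_pow]; exact pow_ne_zero _ hh') ?_ ?_
    · rw [map_mul, map_pow]
      exact mul_ne_zero hc' (pow_ne_zero _ hg')
    · convert H n using 1 <;> ring
  have hkl : k ≤ l := by
    have := (H' (j + 1)).1
    by_contra hlt
    have h2 : (l + 1) * (j + 1) ≤ k * (j + 1) := Nat.mul_le_mul_right _ (not_le.1 hlt)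
    linarith
  exact mul_dvd_mul (pow_dvd_pow _ hkl)
    (hA.dvd_of_constantCoeff_ne_zero hh' hc' fun n => (H' n).2)

theorem IsCompletelyIntegrallyClosed.mvPowerSeries_fin {A : Type*} [CommRing A] [IsDomain A]
    (hA : IsCompletelyIntegrallyClosed A) (n : ℕ) :
    IsCompletelyIntegrallyClosed (MvPowerSeries (Fin n) A) := by
  induction n with
  | zero => exact hA.of_ringEquiv (MvPowerSeries.isEmptyEquiv (Fin 0) A).symm.toRingEquiv
  | succ n ih =>
    have : IsDomain (MvPowerSeries (Fin n) A) := NoZeroDivisors.to_isDomain _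
    exact ih.powerSeries.of_ringEquiv (MvPowerSeries.finSuccEquiv A n).symm.toRingEquiv

end Iwasawa

end


noncomputable section

namespace Iwasawa

open Filter Topology

/-! ### Group rings of finite groups -/

theorem coeff_mapDomainRingHom {R H K : Type*} [CommRing R] [Monoid H] [Monoid K] [Fintype H]
    [DecidableEq K] (f : H →* K) (x : MonoidAlgebra R H) (a : K) :
    (MonoidAlgebra.mapDomainRingHom R f x).coeff a = ∑ b, if f b = a then x.coeff b else 0 := by
  change (Finsupp.mapDomain f x.coeff) a = _
  rw [Finsupp.mapDomain, Finsupp.sum_fintype _ _ (by simp), Finsupp.finsetSum_apply]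
  simp [Finsupp.single_apply]

theorem coeff_mul_eq_sum {R H : Type*} [CommRing R] [Group H] [Fintype H]
    (x y : MonoidAlgebra R H) (a : H) :
    (x * y).coeff a = ∑ b, x.coeff b * y.coeff (b⁻¹ * a) := by
  rw [MonoidAlgebra.coeff_mul_apply_left, Finsupp.sum_fintype _ _ (by simp)]

theorem mapDomainRingHom_surjective {R H K : Type*} [CommRing R] [Monoid H] [Monoid K]
    (f : H →* K) (hf : Function.Surjective f) :
    Function.Surjective (MonoidAlgebra.mapDomainRingHom R f) := by
  intro x
  obtain ⟨y, hy⟩ := Finsupp.mapDomain_surjective hf x.coeff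
  exact ⟨.ofCoeff y, MonoidAlgebra.coeff_injective hy⟩

theorem PadicInt.exists_forall_dvd_imp_mem {p : ℕ} [Fact p.Prime] {W : Set ℤ_[p]}
    (hW : W ∈ 𝓝 (0 : ℤ_[p])) : ∃ n : ℕ, ∀ x : ℤ_[p], (p : ℤ_[p]) ^ n ∣ x → x ∈ W := by
  obtain ⟨ε, hε, hsub⟩ := Metric.mem_nhds_iff.1 hW
  obtain ⟨n, hn⟩ := PadicInt.exists_pow_neg_lt p hε
  refine ⟨n, fun x hx => hsub ?_⟩
  rw [mem_ball_zero_iff]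
  refine lt_of_le_of_lt ((PadicInt.norm_le_pow_iff_mem_span_pow x n).2 ?_) hn
  exact Ideal.mem_span_singleton.2 hx

theorem PadicInt.exists_forall_dvd_imp_mem_pi {p : ℕ} [Fact p.Prime] {ι : Type*} [Fintype ι]
    {W : Set (ι → ℤ_[p])} (hW : W ∈ 𝓝 (0 : ι → ℤ_[p])) :
    ∃ n : ℕ, ∀ f : ι → ℤ_[p], (∀ i, (p : ℤ_[p]) ^ n ∣ f i) → f ∈ W := by
  rw [nhds_pi, mem_pi'] at hW
  obtain ⟨J, s, hs, hJs⟩ := hW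
  choose n hn using fun i => PadicInt.exists_forall_dvd_imp_mem (hs i)
  refine ⟨∑ i, n i, fun f hf => hJs fun i _ => hn i _ ?_⟩
  exact (pow_dvd_pow _ (Finset.single_le_sum (fun _ _ => Nat.zero_le _)
    (Finset.mem_univ i))).trans (hf i)

theorem PadicInt.isOpen_dvd {p : ℕ} [Fact p.Prime] (n : ℕ) :
    IsOpen {x : ℤ_[p] | (p : ℤ_[p]) ^ n ∣ x} := by
  have : {x : ℤ_[p] | (p : ℤ_[p]) ^ n ∣ x} = Metric.closedBall 0 ((p : ℝ) ^ (-n : ℤ)) := by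
    ext x
    rw [mem_closedBall_zero_iff, PadicInt.norm_le_pow_iff_mem_span_pow, Ideal.mem_span_singleton]
    rfl
  rw [this]
  exact IsUltrametricDist.isOpen_closedBall 0
    (zpow_pos (by exact_mod_cast (Fact.out : p.Prime).pos) _).ne'

/-! ### The topology of the completed group algebra -/

section Topology

variable (p : ℕ) [Fact p.Prime] (G : Type*) [CommGroup G] [TopologicalSpace G]

/-- The projection `ℤ_p⟦G⟧ → ℤ_p[G/U]`. -/
def proj (U : OpenSubgroup G) :
    CompletedGroupAlgebra p G →+* MonoidAlgebra ℤ_[p] (G ⧸ (U : Subgroup G)) :=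
  (Pi.evalRingHom _ U).comp (completedGroupSubring p G).subtype

variable {p G} in
theorem ext_proj {x y : CompletedGroupAlgebra p G} (h : ∀ U, proj p G U x = proj p G U y) :
    x = y := Subtype.ext (funext h)

theorem proj_proj {U V : OpenSubgroup G} (h : V ≤ U) (x : CompletedGroupAlgebra p G) :
    groupRingProj p G h (proj p G V x) = proj p G U x := x.2 U V h

/-- The map `ℤ_p[G] → ℤ_p⟦G⟧`. -/
def ofGroupRing : MonoidAlgebra ℤ_[p] G →+* CompletedGroupAlgebra p G :=
  RingHom.codRestrict (RingHom.pi fun U : OpenSubgroup G =>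
      MonoidAlgebra.mapDomainRingHom ℤ_[p] (QuotientGroup.mk' (U : Subgroup G)))
    (completedGroupSubring p G) fun x U V h => by
    change ((MonoidAlgebra.mapDomainRingHom ℤ_[p] _).comp
      (MonoidAlgebra.mapDomainRingHom ℤ_[p] _)) x = _
    rw [← MonoidAlgebra.mapDomainRingHom_comp]
    rfl

theorem proj_ofGroupRing (U : OpenSubgroup G) (x : MonoidAlgebra ℤ_[p] G) :
    proj p G U (ofGroupRing p G x) =
      MonoidAlgebra.mapDomainRingHom ℤ_[p] (QuotientGroup.mk' (U : Subgroup G)) x := rfl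

theorem ofGroupRing_single_one (g : G) :
    ofGroupRing p G (MonoidAlgebra.single g 1) = groupElt p G g := by
  refine ext_proj fun U => ?_
  rw [proj_ofGroupRing]
  exact MonoidAlgebra.mapDomain_single

theorem proj_groupElt (U : OpenSubgroup G) (g : G) :
    proj p G U (groupElt p G g) = MonoidAlgebra.single (g : G ⧸ (U : Subgroup G)) 1 := rfl

/-- The structure map `ℤ_p → ℤ_p⟦G⟧`. -/
def scalar : ℤ_[p] →+* CompletedGroupAlgebra p G :=
  (ofGroupRing p G).comp MonoidAlgebra.singleOneRingHom

theorem proj_scalar (U : OpenSubgroup G) (c : ℤ_[p]) :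
    proj p G U (scalar p G c) = MonoidAlgebra.single 1 c :=
  MonoidAlgebra.mapDomain_single

theorem ofGroupRing_single (g : G) (c : ℤ_[p]) :
    ofGroupRing p G (MonoidAlgebra.single g c) = scalar p G c * groupElt p G g := by
  rw [← ofGroupRing_single_one]
  change _ = ofGroupRing p G (MonoidAlgebra.single 1 c) * _
  rw [← map_mul, MonoidAlgebra.single_mul_single, one_mul, mul_one]

theorem exists_proj_ofGroupRing_eq (U : OpenSubgroup G)
    (x : MonoidAlgebra ℤ_[p] (G ⧸ (U : Subgroup G))) :
    ∃ y, proj p G U (ofGroupRing p G y) = x :=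
  mapDomainRingHom_surjective _ (QuotientGroup.mk'_surjective _) x

theorem proj_surjective (U : OpenSubgroup G) : Function.Surjective (proj p G U) := fun x =>
  (exists_proj_ofGroupRing_eq p G U x).imp' _ fun _ h => h

/-- All coefficients of an element of `ℤ_p⟦G⟧` at all finite levels. -/
def coeffs (x : CompletedGroupAlgebra p G) (U : OpenSubgroup G) (g : G ⧸ (U : Subgroup G)) :
    ℤ_[p] := (proj p G U x).coeff g

theorem isInducing_coeffs : IsInducing (coeffs p G) := ⟨rfl⟩

theorem continuous_coeff_proj (U : OpenSubgroup G) (g : G ⧸ (U : Subgroup G)) :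
    Continuous fun x : CompletedGroupAlgebra p G => (proj p G U x).coeff g :=
  continuous_pi_iff.1 (continuous_pi_iff.1 (isInducing_coeffs p G).continuous U) g

variable {p G} in
theorem continuous_of_coeff_proj {X : Type*} [TopologicalSpace X]
    {f : X → CompletedGroupAlgebra p G}
    (h : ∀ U g, Continuous fun x => (proj p G U (f x)).coeff g) : Continuous f :=
  (isInducing_coeffs p G).continuous_iff.2 (continuous_pi fun U => continuous_pi fun g => h U g)

set_option linter.unusedSectionVars false

variable [IsTopologicalGroup G] [CompactSpace G]

instance (U : OpenSubgroup G) : Finite (G ⧸ (U : Subgroup G)) :=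
  Subgroup.quotient_finite_of_isOpen _ U.isOpen

instance (U : OpenSubgroup G) : Fintype (G ⧸ (U : Subgroup G)) := Fintype.ofFinite _

instance : IsTopologicalRing (CompletedGroupAlgebra p G) where
  continuous_add := continuous_of_coeff_proj fun U g => by
    simp only [map_add, MonoidAlgebra.coeff_add, Finsupp.add_apply]
    exact ((continuous_coeff_proj p G U g).comp continuous_fst).add
      ((continuous_coeff_proj p G U g).comp continuous_snd)
  continuous_mul := continuous_of_coeff_proj fun U g => by
    simp only [map_mul, coeff_mul_eq_sum]
    exact continuous_finsetSum _ fun h _ =>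
      ((continuous_coeff_proj p G U _).comp continuous_fst).mul
        ((continuous_coeff_proj p G U _).comp continuous_snd)
  continuous_neg := continuous_of_coeff_proj fun U g => by
    simp only [map_neg, MonoidAlgebra.coeff_neg, Finsupp.neg_apply]
    exact (continuous_coeff_proj p G U g).neg

/-- The image is cut out of the product of copies of ℤ_p by the compatibility equations, each
involving finitely many coordinates. This is what makes ℤ_p⟦G⟧ compact and Hausdorff. -/
theorem isClosedEmbedding_coeffs : IsClosedEmbedding (coeffs p G) := by
  classical
  refine ⟨⟨isInducing_coeffs p G, ?_⟩, ?_⟩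
  · intro x y h
    refine ext_proj fun U => MonoidAlgebra.coeff_injective (Finsupp.ext fun g => ?_)
    exact congr_fun (congr_fun h U) g
  · have : Set.range (coeffs p G) =
        ⋂ (U : OpenSubgroup G) (V : OpenSubgroup G) (h : V ≤ U) (a : G ⧸ (U : Subgroup G)),
          {x | (∑ b : G ⧸ (V : Subgroup G), if QuotientGroup.map (V : Subgroup G) (U : Subgroup G)
            (MonoidHom.id G) (fun _ hx => h hx) b = a then x V b else 0) = x U a} := by
      ext x
      simp only [Set.mem_range, Set.mem_iInter, Set.mem_ofPred_eq]
      constructor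
      · rintro ⟨x, rfl⟩ U V h a
        simp only [coeffs]
        rw [← coeff_mapDomainRingHom]
        exact congrArg (fun y => MonoidAlgebra.coeff y a) (x.2 U V h)
      · intro h
        refine ⟨⟨fun U => .ofCoeff (Finsupp.equivFunOnFinite.symm (x U)), fun U V hUV => ?_⟩, rfl⟩
        refine MonoidAlgebra.coeff_injective (Finsupp.ext fun a => ?_)
        exact (coeff_mapDomainRingHom _ _ _).trans (h U V hUV a)
    rw [this]
    refine isClosed_iInter fun U => isClosed_iInter fun V => isClosed_iInter fun h =>
      isClosed_iInter fun a => isClosed_eq ?_ ?_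
    · refine continuous_finsetSum _ fun b _ => ?_
      split_ifs
      · exact (continuous_apply b).comp (continuous_apply V)
      · exact continuous_const
    · exact (continuous_apply a).comp (continuous_apply U)

instance : CompactSpace (CompletedGroupAlgebra p G) :=
  (isClosedEmbedding_coeffs p G).compactSpace

instance : T2Space (CompletedGroupAlgebra p G) :=
  (isClosedEmbedding_coeffs p G).isEmbedding.t2Space

/-- The open ideals `{x | x_U ∈ p^n ℤ_p[G/U]}` of `ℤ_p⟦G⟧`. -/
def openIdeal (U : OpenSubgroup G) (n : ℕ) : Ideal (CompletedGroupAlgebra p G) :=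
  RingHom.ker ((MonoidAlgebra.mapRingHom (G ⧸ (U : Subgroup G)) (PadicInt.toZModPow (p := p) n)).comp
    (proj p G U))

variable {p G}

theorem mem_openIdeal {U : OpenSubgroup G} {n : ℕ} {x : CompletedGroupAlgebra p G} :
    x ∈ openIdeal p G U n ↔ ∀ g, (p : ℤ_[p]) ^ n ∣ (proj p G U x).coeff g := by
  rw [openIdeal, RingHom.mem_ker, ← MonoidAlgebra.coeff_eq_zero, Finsupp.ext_iff]
  refine forall_congr' fun g => ?_
  rw [RingHom.comp_apply, MonoidAlgebra.coeff_mapRingHom, Finsupp.zero_apply, ← RingHom.mem_ker,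
    PadicInt.ker_toZModPow, Ideal.mem_span_singleton]

theorem openIdeal_anti {U V : OpenSubgroup G} (h : V ≤ U) {n m : ℕ} (hn : n ≤ m) :
    openIdeal p G V m ≤ openIdeal p G U n := by
  classical
  intro x hx
  rw [mem_openIdeal] at hx ⊢
  intro g
  rw [← proj_proj p G h, groupRingProj, coeff_mapDomainRingHom]
  refine Finset.dvd_sum fun b _ => ?_
  split_ifs
  · exact (pow_dvd_pow _ hn).trans (hx b)
  · exact dvd_zero _

theorem isOpen_openIdeal (U : OpenSubgroup G) (n : ℕ) :
    IsOpen (openIdeal p G U n : Set (CompletedGroupAlgebra p G)) := by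
  have : (openIdeal p G U n : Set (CompletedGroupAlgebra p G)) =
      ⋂ g, (fun x => (proj p G U x).coeff g) ⁻¹' {x : ℤ_[p] | (p : ℤ_[p]) ^ n ∣ x} := by
    ext x
    simp [mem_openIdeal]
  rw [this]
  exact isOpen_iInter_of_finite fun g =>
    (PadicInt.isOpen_dvd n).preimage (continuous_coeff_proj p G U g)

theorem exists_openIdeal_subset {W : Set (CompletedGroupAlgebra p G)} (hW : W ∈ 𝓝 0) :
    ∃ U n, (openIdeal p G U n : Set (CompletedGroupAlgebra p G)) ⊆ W := by
  have h0 : coeffs p G 0 = 0 := rfl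
  rw [(isInducing_coeffs p G).nhds_eq_comap, mem_comap, h0] at hW
  obtain ⟨W', hW', hsub⟩ := hW
  rw [nhds_pi, mem_pi'] at hW'
  obtain ⟨I, t, ht, hIt⟩ := hW'
  have ht' : ∀ U : OpenSubgroup G, ∃ n : ℕ, ∀ f : G ⧸ (U : Subgroup G) → ℤ_[p],
      (∀ i, (p : ℤ_[p]) ^ n ∣ f i) → f ∈ t U :=
    fun U => PadicInt.exists_forall_dvd_imp_mem_pi (ht U)
  choose n hn using ht'
  -- A basic neighbourhood constrains finitely many levels; one level below all of them and the
  -- largest exponent suffice.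
  refine ⟨I.inf id, I.sup n, fun x hx => hsub (hIt fun U hU => hn U _ ?_)⟩
  have h1 : I.inf id ≤ U := Finset.inf_le (f := id) hU
  exact mem_openIdeal.1 (openIdeal_anti h1 (Finset.le_sup hU) hx)

theorem hasBasis_openIdeal : (𝓝 (0 : CompletedGroupAlgebra p G)).HasBasis
    (fun _ : OpenSubgroup G × ℕ => True) fun i => openIdeal p G i.1 i.2 := by
  refine ⟨fun W => ⟨fun hW => ?_, ?_⟩⟩
  · obtain ⟨U, n, h⟩ := exists_openIdeal_subset hW
    exact ⟨(U, n), trivial, h⟩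
  · rintro ⟨⟨U, n⟩, -, h⟩
    exact mem_of_superset ((isOpen_openIdeal U n).mem_nhds (zero_mem _)) h

instance : IsLinearTopology (CompletedGroupAlgebra p G) (CompletedGroupAlgebra p G) :=
  IsLinearTopology.mk_of_hasBasis _ hasBasis_openIdeal

/-- A closed set containing an element congruent to `x` at every finite level contains `x`. -/
theorem mem_of_isClosed {C : Set (CompletedGroupAlgebra p G)} (hC : IsClosed C)
    {x : CompletedGroupAlgebra p G} (h : ∀ U, ∃ y ∈ C, proj p G U y = proj p G U x) : x ∈ C := by
  rw [← hC.closure_eq, mem_closure_iff_nhds]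
  intro W hW
  have h0 : (fun z => x + z) ⁻¹' W ∈ 𝓝 (0 : CompletedGroupAlgebra p G) :=
    (continuous_const.add continuous_id).continuousAt.preimage_mem_nhds (by simpa using hW)
  obtain ⟨U, n, hU⟩ := exists_openIdeal_subset h0
  obtain ⟨y, hyC, hy⟩ := h U
  refine ⟨y, ?_, hyC⟩
  have : y - x ∈ openIdeal p G U n := mem_openIdeal.2 fun g => by simp [hy]
  simpa using hU this

theorem continuous_scalar : Continuous (scalar p G) :=
  continuous_of_coeff_proj fun U g => by
    classical
    simp only [proj_scalar, MonoidAlgebra.coeff_single, Finsupp.single_apply]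
    split_ifs
    · exact continuous_id
    · exact continuous_const

end Topology

end Iwasawa

end


noncomputable section

namespace Iwasawa

open Filter Topology

/-! ### The completed group algebra as a power series ring -/

section PowerSeriesIdeals

variable {p : ℕ} [Fact p.Prime] {σ : Type*}

/-- The ideal of power series all of whose coefficients of degree less than `m` in each variable
are divisible by `p ^ m`. -/
def truncIdeal (p : ℕ) [Fact p.Prime] (σ : Type*) (m : ℕ) : Ideal (MvPowerSeries σ ℤ_[p]) where
  carrier := {f | ∀ k : σ →₀ ℕ, (∀ i, k i < m) → (p : ℤ_[p]) ^ m ∣ MvPowerSeries.coeff k f}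
  add_mem' hf hg k hk := by
    rw [map_add]
    exact dvd_add (hf k hk) (hg k hk)
  zero_mem' k _ := by simp
  smul_mem' c f hf k hk := by
    classical
    rw [smul_eq_mul, MvPowerSeries.coeff_mul]
    refine Finset.dvd_sum fun ab hab => Dvd.dvd.mul_left (hf ab.2 fun i => ?_) _
    refine lt_of_le_of_lt ?_ (hk i)
    rw [← Finset.HasAntidiagonal.mem_antidiagonal.1 hab, Finsupp.add_apply]
    exact Nat.le_add_left _ _

theorem mem_truncIdeal {m : ℕ} {f : MvPowerSeries σ ℤ_[p]} : f ∈ truncIdeal p σ m ↔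
    ∀ k : σ →₀ ℕ, (∀ i, k i < m) → (p : ℤ_[p]) ^ m ∣ MvPowerSeries.coeff k f := Iff.rfl

theorem C_pow_mem_truncIdeal (m : ℕ) : (p : MvPowerSeries σ ℤ_[p]) ^ m ∈ truncIdeal p σ m := by
  intro k _
  have : (p : MvPowerSeries σ ℤ_[p]) ^ m = MvPowerSeries.C ((p : ℤ_[p]) ^ m) := by simp
  rw [this, ← mul_one (MvPowerSeries.C _), MvPowerSeries.coeff_C_mul]
  exact dvd_mul_right _ _

theorem X_pow_mem_truncIdeal (m : ℕ) (i : σ) :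
    (MvPowerSeries.X i : MvPowerSeries σ ℤ_[p]) ^ m ∈ truncIdeal p σ m := by
  classical
  intro k hk
  rw [MvPowerSeries.coeff_X_pow, if_neg]
  · exact dvd_zero _
  · rintro rfl
    simpa using hk i

theorem eq_zero_of_forall_mem_truncIdeal [Finite σ] {f : MvPowerSeries σ ℤ_[p]}
    (h : ∀ m, f ∈ truncIdeal p σ m) : f = 0 := by
  have := Fintype.ofFinite σ
  ext k
  rw [map_zero]
  by_contra h0
  obtain ⟨n, hn⟩ := FiniteMultiplicity.of_not_isUnit (PadicInt.prime_p (p := p)).not_isUnit h0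
  -- The index exceeds both the p-adic valuation bound n and every exponent of k.
  refine hn ((pow_dvd_pow _ ?_).trans (h (n + 1 + ∑ i, k i + 1) k fun i => ?_))
  · omega
  · have := Finset.single_le_sum (f := fun i => k i) (fun _ _ => Nat.zero_le _) (Finset.mem_univ i)
    omega

open scoped MvPowerSeries.WithPiTopology in
theorem isOpen_truncIdeal [Finite σ] (m : ℕ) :
    IsOpen (truncIdeal p σ m : Set (MvPowerSeries σ ℤ_[p])) := by
  have : (truncIdeal p σ m : Set (MvPowerSeries σ ℤ_[p])) =
      ⋂ k ∈ {k : σ →₀ ℕ | ∀ i, k i < m},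
        MvPowerSeries.coeff k ⁻¹' {x : ℤ_[p] | (p : ℤ_[p]) ^ m ∣ x} := by
    ext f
    simp [mem_truncIdeal]
  rw [this]
  have hfin : {k : σ →₀ ℕ | ∀ i, k i < m}.Finite := by
    have := Fintype.ofFinite σ
    refine Set.Finite.of_finite_image (f := fun k => (k : σ → ℕ))
      ((Set.Finite.pi' fun _ : σ => Set.finite_lt_nat m).subset ?_) DFunLike.coe_injective.injOn
    rintro _ ⟨k, hk, rfl⟩ i
    exact hk i
  exact hfin.isOpen_biInter fun k _ =>
    (PadicInt.isOpen_dvd m).preimage (MvPowerSeries.WithPiTopology.continuous_coeff _ k)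

/-- Modulo `truncIdeal m`, the element `1 + X i` has `p`-power order. -/
theorem exists_one_add_X_pow_eq_one (m : ℕ) : ∃ N : ℕ, ∀ i : σ,
    (1 + Ideal.Quotient.mk (truncIdeal p σ m) (MvPowerSeries.X i)) ^ p ^ N = 1 := by
  have hp : p.Prime := Fact.out
  -- The first p^m-th power kills the X-part modulo p; the second lifts the congruence from modulo p
  -- to modulo p^(m+1), where p^(m+1) is zero.
  refine ⟨m + m, fun i => ?_⟩
  set t := Ideal.Quotient.mk (truncIdeal p σ m) (MvPowerSeries.X i)
  have ht : t ^ p ^ m = 0 := by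
    have h1 : t ^ m = 0 := by
      rw [← map_pow]
      exact Ideal.Quotient.eq_zero_iff_mem.2 (X_pow_mem_truncIdeal m i)
    exact pow_eq_zero_of_le (Nat.lt_pow_self hp.one_lt).le h1
  have h2 : (p : MvPowerSeries σ ℤ_[p] ⧸ truncIdeal p σ m) ∣ (1 + t) ^ p ^ m - 1 := by
    rw [(Commute.all 1 t).add_pow_prime_pow_eq hp, ht, one_pow, add_zero, add_sub_cancel_left,
      mul_assoc, mul_assoc]
    exact dvd_mul_right _ _
  have h3 := dvd_sub_pow_of_dvd_sub h2 m
  have h4 : (p : MvPowerSeries σ ℤ_[p] ⧸ truncIdeal p σ m) ^ (m + 1) = 0 := by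
    rw [pow_succ]
    have := Ideal.Quotient.eq_zero_iff_mem.2 (C_pow_mem_truncIdeal (p := p) (σ := σ) m)
    rw [map_pow, map_natCast] at this
    rw [this, zero_mul]
  rw [h4, zero_dvd_iff, one_pow, ← pow_mul, ← pow_add, sub_eq_zero] at h3
  exact h3

end PowerSeriesIdeals

/-! ### Evaluation of power series at topologically nilpotent elements -/

section Evaluation

set_option linter.unusedSectionVars false

variable {p : ℕ} [Fact p.Prime] {G : Type*} [CommGroup G] [TopologicalSpace G]
  [IsTopologicalGroup G] [CompactSpace G]

-- Evaluation at a converges because ℤ_p⟦G⟧ is compact, hence complete, and its topology is linear.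
open scoped MvPowerSeries.WithPiTopology in
theorem exists_continuous_powerSeriesHom {d : ℕ} (a : Fin d → CompletedGroupAlgebra p G)
    (ha : ∀ i, IsTopologicallyNilpotent (a i)) :
    ∃ φ : MvPowerSeries (Fin d) ℤ_[p] →+* CompletedGroupAlgebra p G, Continuous φ ∧
      (∀ c, φ (MvPowerSeries.C c) = scalar p G c) ∧ ∀ i, φ (MvPowerSeries.X i) = a i := by
  let _ : UniformSpace (CompletedGroupAlgebra p G) := IsTopologicalAddGroup.rightUniformSpace _
  have : IsUniformAddGroup (CompletedGroupAlgebra p G) := isUniformAddGroup_of_addCommGroup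
  have hev : MvPowerSeries.HasEval a := ⟨ha, by simp [cofinite_eq_bot]⟩
  have hc := continuous_scalar (p := p) (G := G)
  refine ⟨MvPowerSeries.eval₂Hom hc hev, ?_, fun c => ?_, fun i => ?_⟩
  · rw [MvPowerSeries.coe_eval₂Hom]
    exact MvPowerSeries.continuous_eval₂ hc hev
  · rw [MvPowerSeries.coe_eval₂Hom, MvPowerSeries.eval₂_C]
  · rw [MvPowerSeries.coe_eval₂Hom, MvPowerSeries.eval₂_X]

theorem natCast_pow_mem_openIdeal (U : OpenSubgroup G) (n : ℕ) :
    (p : CompletedGroupAlgebra p G) ^ n ∈ openIdeal p G U n := by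
  refine mem_openIdeal.2 fun a => ?_
  have : proj p G U ((p : CompletedGroupAlgebra p G) ^ n) =
      ((p : ℤ_[p]) ^ n) • (1 : MonoidAlgebra ℤ_[p] (G ⧸ (U : Subgroup G))) := by
    rw [map_pow, map_natCast, ← Nat.cast_pow, ← Nat.cast_pow, Nat.cast_smul_eq_nsmul,
      nsmul_eq_mul, mul_one]
  rw [this, MonoidAlgebra.coeff_smul_apply]
  exact dvd_mul_right _ _

/-- In a pro-`p` group, `g - 1` is nilpotent modulo every open ideal. -/
theorem isNilpotent_mk_groupElt_sub_one (hG : ∀ (U : OpenSubgroup G) (g : G), ∃ k, g ^ p ^ k ∈ U)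
    (U : OpenSubgroup G) (n : ℕ) (g : G) :
    IsNilpotent (Ideal.Quotient.mk (openIdeal p G U n) (groupElt p G g - 1)) := by
  have hp : p.Prime := Fact.out
  obtain ⟨k, hk⟩ := hG U g
  set π := Ideal.Quotient.mk (openIdeal p G U n)
  have h1 : π (groupElt p G g) ^ p ^ k = 1 := by
    rw [← map_pow, ← map_pow, ← map_one π]
    refine Ideal.Quotient.eq.2 (mem_openIdeal.2 fun a => ?_)
    have : proj p G U (groupElt p G (g ^ p ^ k) - 1) = 0 := by
      rw [map_sub, proj_groupElt, (QuotientGroup.eq_one_iff _).2 hk, map_one, sub_eq_zero]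
      rfl
    rw [this]
    exact dvd_zero _
  have h2 : π (p : CompletedGroupAlgebra p G) ^ n = 0 := by
    rw [← map_pow]
    exact Ideal.Quotient.eq_zero_iff_mem.2 (natCast_pow_mem_openIdeal U n)
  -- Modulo p, raising to the power p^k is additive, so (g - 1)^(p^k) agrees with g^(p^k) - 1 = 0.
  have h3 : (p : CompletedGroupAlgebra p G ⧸ openIdeal p G U n) ∣
      (π (groupElt p G g - 1)) ^ p ^ k := by
    obtain ⟨r, hr⟩ : ∃ r, (π (groupElt p G g - 1) + 1) ^ p ^ k =
        π (groupElt p G g - 1) ^ p ^ k + 1 ^ p ^ k + p * r :=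
      ⟨_, by rw [(Commute.all _ _).add_pow_prime_pow_eq hp, mul_assoc, mul_assoc]⟩
    rw [map_sub, map_one, sub_add_cancel, h1, one_pow] at hr
    rw [map_sub, map_one]
    exact ⟨-r, by linear_combination -hr⟩
  refine ⟨p ^ k * n, ?_⟩
  rw [pow_mul]
  obtain ⟨r, hr⟩ := h3
  rw [map_natCast] at h2
  rw [hr, mul_pow, h2, zero_mul]

theorem isTopologicallyNilpotent_of_isNilpotent_mk {x : CompletedGroupAlgebra p G}
    (h : ∀ U n, IsNilpotent (Ideal.Quotient.mk (openIdeal p G U n) x)) :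
    IsTopologicallyNilpotent x := by
  refine (hasBasis_openIdeal.tendsto_right_iff).2 fun ⟨U, n⟩ _ => ?_
  obtain ⟨N, hN⟩ := h U n
  filter_upwards [eventually_ge_atTop N] with m hm
  rw [← Nat.sub_add_cancel hm, pow_add]
  rw [← map_pow] at hN
  exact Ideal.mul_mem_left _ _ (Ideal.Quotient.eq_zero_iff_mem.1 hN)

end Evaluation

/-! ### The isomorphism with power series for G ≅ ℤ_p^d -/

section Lattice

set_option linter.unusedSectionVars false

variable {p : ℕ} [Fact p.Prime] {G : Type*} [CommGroup G] [TopologicalSpace G]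
  [IsTopologicalGroup G] [CompactSpace G] {d : ℕ} (e : G ≃ₜ* Multiplicative (Fin d → ℤ_[p]))

/-- The topological generators of `G ≅ ℤ_p^d`. -/
def gen (i : Fin d) : G := e.symm (Multiplicative.ofAdd (Pi.single i 1))

theorem symm_natCast_eq_prod (a : Fin d → ℕ) :
    e.symm (Multiplicative.ofAdd fun i => (a i : ℤ_[p])) = ∏ i, gen e i ^ a i := by
  simp only [gen, ← map_pow, ← map_prod]
  congr 1
  refine Multiplicative.toAdd.injective (funext fun i => ?_)
  rw [toAdd_prod, Finset.sum_apply]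
  simp [Pi.single_apply]

include e in
theorem exists_pow_mem (U : OpenSubgroup G) (g : G) : ∃ k, g ^ p ^ k ∈ U := by
  let f : ℤ_[p] → G := fun c => e.symm (Multiplicative.ofAdd (c • (e g).toAdd))
  have hf : Continuous f := e.symm.continuous.comp
    (continuous_ofAdd.comp (continuous_id.smul continuous_const))
  have h0 : f 0 = 1 := by
    simp only [f, zero_smul, ofAdd_zero, map_one]
  obtain ⟨n, hn⟩ := PadicInt.exists_forall_dvd_imp_mem
    (hf.continuousAt.preimage_mem_nhds (h0 ▸ U.mem_nhds_one : (U : Set G) ∈ 𝓝 (f 0)))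
  refine ⟨n, ?_⟩
  have h1 : f ((p : ℤ_[p]) ^ n) ∈ U := hn _ dvd_rfl
  have h2 : f ((p : ℤ_[p]) ^ n) = g ^ p ^ n := by
    simp only [f]
    rw [← Nat.cast_pow, Nat.cast_smul_eq_nsmul, ofAdd_nsmul, ofAdd_toAdd, map_pow,
      ContinuousMulEquiv.symm_apply_apply]
  rwa [h2] at h1

/-- ℕ^d is dense in ℤ_p^d, so monomials in the generators meet every coset of U. -/
theorem exists_prod_gen_pow_mem (U : OpenSubgroup G) (g : G) :
    ∃ a : Fin d → ℕ, g⁻¹ * ∏ i, gen e i ^ a i ∈ U := by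
  let f : (Fin d → ℤ_[p]) → G := fun v => g⁻¹ * e.symm (Multiplicative.ofAdd v)
  have hf : Continuous f := continuous_const.mul (e.symm.continuous.comp continuous_ofAdd)
  have hd : DenseRange (Pi.map fun (_ : Fin d) (a : ℕ) => (a : ℤ_[p])) :=
    DenseRange.piMap fun _ => PadicInt.denseRange_natCast
  obtain ⟨a, ha⟩ := hd.exists_mem_open (U.isOpen.preimage hf)
    ⟨(e g).toAdd, by simp [f]⟩
  refine ⟨a, ?_⟩
  rw [← symm_natCast_eq_prod]
  exact ha

-- The image is compact, hence closed, so it is enough to reach x at each finite level. There every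
-- coset is a monomial in the generators, the image of a product of powers of 1 + X_i.
open scoped MvPowerSeries.WithPiTopology in
theorem range_eq_top_of_mem {φ : MvPowerSeries (Fin d) ℤ_[p] →+* CompletedGroupAlgebra p G}
    (hφ : Continuous φ) (hC : ∀ c, φ (MvPowerSeries.C c) = scalar p G c)
    (hX : ∀ i, φ (MvPowerSeries.X i) = groupElt p G (gen e i) - 1) : Function.Surjective φ := by
  have : CompactSpace (MvPowerSeries (Fin d) ℤ_[p]) :=
    inferInstanceAs (CompactSpace ((Fin d →₀ ℕ) → ℤ_[p]))
  have hcl : IsClosed (Set.range φ) := (isCompact_range hφ).isClosed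
  intro x
  refine mem_of_isClosed hcl fun U => ?_
  choose a ha using fun q : G ⧸ (U : Subgroup G) => exists_prod_gen_pow_mem e U q.out
  have h1 : ∀ q : G ⧸ (U : Subgroup G), ((∏ i, gen e i ^ a q i : G) : G ⧸ (U : Subgroup G)) = q := by
    intro q
    conv_rhs => rw [← q.out_eq]
    exact (QuotientGroup.eq.2 (ha q)).symm
  refine ⟨_, ⟨∑ q, MvPowerSeries.C ((proj p G U x).coeff q) *
    ∏ i, (1 + MvPowerSeries.X i) ^ a q i, rfl⟩, ?_⟩
  have h2 : ∀ q : G ⧸ (U : Subgroup G), proj p G U (φ (MvPowerSeries.C ((proj p G U x).coeff q) *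
      ∏ i, (1 + MvPowerSeries.X i) ^ a q i)) =
        MonoidAlgebra.single q ((proj p G U x).coeff q) := by
    intro q
    rw [map_mul, map_prod, hC]
    simp only [map_pow, map_add, map_one, hX, add_sub_cancel]
    simp only [← map_pow, ← map_prod]
    rw [map_mul, proj_scalar, proj_groupElt, h1, MonoidAlgebra.single_mul_single, one_mul, mul_one]
  rw [map_sum, map_sum, Finset.sum_congr rfl fun q _ => h2 q]
  conv_rhs => rw [← MonoidAlgebra.sum_coeff_single (proj p G U x)]
  rw [Finsupp.sum_fintype _ _ (by simp)]

/-- The ring homomorphism to `ℤ_p⟦T⟧` modulo `truncIdeal m` which sends `gen i` to `1 + X i`. -/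
theorem exists_hom_quotient_truncIdeal (m : ℕ) : ∃ (U : OpenSubgroup G)
    (ψ : MonoidAlgebra ℤ_[p] (G ⧸ (U : Subgroup G)) →+*
      MvPowerSeries (Fin d) ℤ_[p] ⧸ truncIdeal p (Fin d) m),
      (∀ c, ψ (MonoidAlgebra.single 1 c) = Ideal.Quotient.mk _ (MvPowerSeries.C c)) ∧
      ∀ i, ψ (MonoidAlgebra.single ((gen e i : G) : G ⧸ (U : Subgroup G)) 1) =
        1 + Ideal.Quotient.mk _ (MvPowerSeries.X i) := by
  obtain ⟨N, hN⟩ := exists_one_add_X_pow_eq_one (p := p) (σ := Fin d) m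
  have hp : p.Prime := Fact.out
  set Q := MvPowerSeries (Fin d) ℤ_[p] ⧸ truncIdeal p (Fin d) m
  let u : Fin d → Qˣ := fun i =>
    Units.ofPowEqOne (1 + Ideal.Quotient.mk _ (MvPowerSeries.X i)) (p ^ N) (hN i)
      (pow_ne_zero _ hp.ne_zero)
  have hu : ∀ i, u i ^ p ^ N = 1 := fun i => Units.ext (by simp [u])
  let v : Fin d → (ZMod (p ^ N) →+ Additive Qˣ) := fun i =>
    ZMod.lift (p ^ N) ⟨zmultiplesHom _ (Additive.ofMul (u i)), by
      rw [zmultiplesHom_apply, natCast_zsmul, ← ofMul_pow, hu, ofMul_one]⟩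
  have hv : ∀ i, v i 1 = Additive.ofMul (u i) := fun i => by
    have := ZMod.lift_coe (p ^ N) (⟨zmultiplesHom _ (Additive.ofMul (u i)), by
      rw [zmultiplesHom_apply, natCast_zsmul, ← ofMul_pow, hu, ofMul_one]⟩ :
      {f : ℤ →+ Additive Qˣ // f (p ^ N : ℕ) = 0}) 1
    simpa using this
  -- The rule g_i ↦ 1 + X_i extends from ℕ^d to ℤ_p^d because 1 + X_i has order dividing p^N; the
  -- kernel is open since it contains p^N ℤ_p^d.
  let χ : G →* Qˣ :=
    { toFun g := ∏ i, (v i (PadicInt.toZModPow N ((e g).toAdd i))).toMul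
      map_one' := by simp
      map_mul' g h := by simp [Finset.prod_mul_distrib] }
  let U : OpenSubgroup G :=
    { toSubgroup := χ.ker
      isOpen' := by
        have hopen : IsOpen ((fun g => (e g).toAdd) ⁻¹'
            ⋂ i, (fun v : Fin d → ℤ_[p] => v i) ⁻¹' {x : ℤ_[p] | (p : ℤ_[p]) ^ N ∣ x}) :=
          (isOpen_iInter_of_finite fun i => (PadicInt.isOpen_dvd N).preimage
            (continuous_apply i)).preimage (continuous_toAdd.comp e.continuous)
        refine Subgroup.isOpen_of_mem_nhds (g := 1) _
          (mem_of_superset (hopen.mem_nhds (by simp)) fun g hg => ?_)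
        change ∏ i, (v i (PadicInt.toZModPow N ((e g).toAdd i))).toMul = 1
        refine Finset.prod_eq_one fun i _ => ?_
        have h0 : PadicInt.toZModPow N ((e g).toAdd i) = 0 := by
          rw [← RingHom.mem_ker, PadicInt.ker_toZModPow, Ideal.mem_span_singleton]
          exact Set.mem_iInter.1 hg i
        rw [h0, map_zero, toMul_zero] }
  have hχ : ∀ i, χ (gen e i) = u i := fun i => by
    change ∏ j, (v j (PadicInt.toZModPow N ((e (gen e i)).toAdd j))).toMul = u i
    rw [Finset.prod_eq_single i]
    · simp [gen, hv]
    · intro j _ hj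
      simp [gen, hj]
    · simp
  let χ' : G ⧸ (U : Subgroup G) →* Q := (Units.coeHom Q).comp (QuotientGroup.lift _ χ fun _ h => h)
  refine ⟨U, MonoidAlgebra.liftNCRingHom ((Ideal.Quotient.mk _).comp MvPowerSeries.C) χ'
    fun _ _ => Commute.all _ _, fun c => ?_, fun i => ?_⟩
  · rw [MonoidAlgebra.liftNCRingHom_single, map_one, mul_one]
    rfl
  · rw [MonoidAlgebra.liftNCRingHom_single, map_one, one_mul]
    exact (congrArg Units.val (hχ i)).trans rfl

-- A finite level of ℤ_p⟦G⟧ recovers power series modulo `truncIdeal m`: the composite with φ is the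
-- quotient map on polynomials. Approximating f in the kernel of φ by a polynomial F, with f - F and
-- its image both small, gives f ∈ `truncIdeal m` for every m.
open scoped MvPowerSeries.WithPiTopology in
theorem injective_of_mem {φ : MvPowerSeries (Fin d) ℤ_[p] →+* CompletedGroupAlgebra p G}
    (hφ : Continuous φ) (hC : ∀ c, φ (MvPowerSeries.C c) = scalar p G c)
    (hX : ∀ i, φ (MvPowerSeries.X i) = groupElt p G (gen e i) - 1) : Function.Injective φ := by
  refine (injective_iff_map_eq_zero φ).2 fun f hf => eq_zero_of_forall_mem_truncIdeal fun m => ?_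
  obtain ⟨U, ψ, hψC, hψ⟩ := exists_hom_quotient_truncIdeal e m
  let Ψ := (ψ.comp (proj p G U)).comp φ
  have hpoly : ∀ F : MvPolynomial (Fin d) ℤ_[p], Ψ F = Ideal.Quotient.mk _ (F : MvPowerSeries _ _) := by
    intro F
    have : Ψ.comp MvPolynomial.coeToMvPowerSeries.ringHom =
        (Ideal.Quotient.mk _).comp MvPolynomial.coeToMvPowerSeries.ringHom := by
      refine MvPolynomial.ringHom_ext (fun c => ?_) fun i => ?_
      · simp [Ψ, hC, proj_scalar, hψC]
      · simp only [RingHom.comp_apply, MvPolynomial.coeToMvPowerSeries.ringHom_apply,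
          MvPolynomial.coe_X, Ψ, hX, map_sub, proj_groupElt, hψ, map_one, add_sub_cancel_left]
    exact RingHom.congr_fun this F
  have hpm : ∀ x ∈ openIdeal p G U m, ψ (proj p G U x) = 0 := by
    intro x hx
    rw [← MonoidAlgebra.sum_coeff_single (proj p G U x), Finsupp.sum_fintype _ _ (by simp), map_sum]
    refine Finset.sum_eq_zero fun q _ => ?_
    obtain ⟨c, hc⟩ := mem_openIdeal.1 hx q
    have h0 : Ideal.Quotient.mk (truncIdeal p (Fin d) m) (MvPowerSeries.C ((p : ℤ_[p]) ^ m)) = 0 := by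
      have := C_pow_mem_truncIdeal (p := p) (σ := Fin d) m
      rw [Ideal.Quotient.eq_zero_iff_mem]
      simpa using this
    rw [hc, show MonoidAlgebra.single q ((p : ℤ_[p]) ^ m * c) =
      MonoidAlgebra.single 1 ((p : ℤ_[p]) ^ m) * MonoidAlgebra.single q c by
        rw [MonoidAlgebra.single_mul_single, one_mul], map_mul, hψC, h0, zero_mul]
  have hopen : IsOpen ((fun g => f - g) ⁻¹'
      (φ ⁻¹' (openIdeal p G U m : Set (CompletedGroupAlgebra p G)) ∩
        (truncIdeal p (Fin d) m : Set (MvPowerSeries (Fin d) ℤ_[p])))) :=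
    (((isOpen_openIdeal U m).preimage hφ).inter (isOpen_truncIdeal m)).preimage
      (continuous_const.sub continuous_id)
  obtain ⟨F, hF1, hF2⟩ := (MvPowerSeries.WithPiTopology.denseRange_toMvPowerSeries
    (R := ℤ_[p]) (σ := Fin d)).exists_mem_open hopen ⟨f, by simp⟩
  have h1 : Ψ (f - F) = 0 := hpm _ hF1
  have h2 : Ψ f = 0 := by simp [Ψ, hf]
  rw [map_sub, h2, hpoly, zero_sub, neg_eq_zero, Ideal.Quotient.eq_zero_iff_mem] at h1
  simpa using add_mem hF2 h1

include e

/-- `ℤ_p⟦G⟧` is a power series ring in `d` variables when `G ≅ ℤ_p^d`. -/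
theorem nonempty_powerSeries_equiv :
    Nonempty (MvPowerSeries (Fin d) ℤ_[p] ≃+* CompletedGroupAlgebra p G) := by
  obtain ⟨φ, h1, h2, h3⟩ := exists_continuous_powerSeriesHom
    (fun i => groupElt p G (gen e i) - 1) fun i => isTopologicallyNilpotent_of_isNilpotent_mk
      fun U n => isNilpotent_mk_groupElt_sub_one (exists_pow_mem e) U n _
  exact ⟨RingEquiv.ofBijective φ ⟨injective_of_mem e h1 h2 h3, range_eq_top_of_mem e h1 h2 h3⟩⟩

theorem isNoetherianRing_completedGroupAlgebra : IsNoetherianRing (CompletedGroupAlgebra p G) :=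
  isNoetherianRing_of_ringEquiv _ (nonempty_powerSeries_equiv e).some

theorem isDomain_completedGroupAlgebra : IsDomain (CompletedGroupAlgebra p G) :=
  have : IsDomain (MvPowerSeries (Fin d) ℤ_[p]) := NoZeroDivisors.to_isDomain _
  (nonempty_powerSeries_equiv e).some.symm.toMulEquiv.isDomain _

theorem isIntegrallyClosed_completedGroupAlgebra :
    IsIntegrallyClosed (CompletedGroupAlgebra p G) :=
  have := isDomain_completedGroupAlgebra e
  (((isCompletelyIntegrallyClosed_of_valuationRing ℤ_[p]).mvPowerSeries_fin d).of_ringEquiv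
    (nonempty_powerSeries_equiv e).some).isIntegrallyClosed

end Lattice

end Iwasawa

end


noncomputable section

namespace Iwasawa

open Filter Topology

/-! ### Augmentation ideals -/

section Augmentation

set_option linter.unusedSectionVars false

variable (p : ℕ) [Fact p.Prime] {G : Type*} [CommGroup G] [TopologicalSpace G]

/-- The ideal of `ℤ_p⟦G⟧` generated by the elements `u - 1`, `u ∈ U`. -/
def augIdeal (U : OpenSubgroup G) : Ideal (CompletedGroupAlgebra p G) :=
  Ideal.span {x | ∃ u ∈ U, x = groupElt p G u - 1}

variable {p}

theorem groupElt_sub_one_mem {U : OpenSubgroup G} {u : G} (hu : u ∈ U) :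
    groupElt p G u - 1 ∈ augIdeal p U := Ideal.subset_span ⟨u, hu, rfl⟩

theorem coinvariantsKer_eq (M : Type*) [AddCommGroup M] [Module (CompletedGroupAlgebra p G) M]
    (U : OpenSubgroup G) : coinvariantsKer p M U = augIdeal p U • ⊤ := by
  apply le_antisymm
  · refine Submodule.span_le.2 ?_
    rintro _ ⟨u, hu, m, rfl⟩
    have : groupElt p G u • m - m = (groupElt p G u - 1) • m := by rw [sub_smul, one_smul]
    rw [this]
    exact Submodule.smul_mem_smul (groupElt_sub_one_mem hu) trivial
  · rw [augIdeal, ← Submodule.span_univ, Submodule.span_smul_span, Submodule.span_le]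
    rintro _ ⟨_, ⟨u, hu, rfl⟩, m, -, rfl⟩
    refine Submodule.subset_span ⟨u, hu, m, ?_⟩
    simp only [sub_smul, one_smul]

variable [IsTopologicalGroup G] [CompactSpace G]

theorem ofGroupRing_mem_augIdeal {U : OpenSubgroup G} {z : MonoidAlgebra ℤ_[p] G}
    (hz : proj p G U (ofGroupRing p G z) = 0) : ofGroupRing p G z ∈ augIdeal p U := by
  -- An additive section through coset representatives. It changes g only by g - g' = g'(g'⁻¹g - 1),
  -- an element of the augmentation ideal.
  let s : MonoidAlgebra ℤ_[p] (G ⧸ (U : Subgroup G)) →+ CompletedGroupAlgebra p G :=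
    MonoidAlgebra.liftNC (scalar p G : ℤ_[p] →+ _) fun q => groupElt p G q.out
  have key : ∀ z : MonoidAlgebra ℤ_[p] G,
      ofGroupRing p G z - s (proj p G U (ofGroupRing p G z)) ∈ augIdeal p U := by
    intro z
    induction z using MonoidAlgebra.induction_linear with
    | zero => simp
    | add x y hx hy =>
      simp only [map_add]
      rw [add_sub_add_comm]
      exact add_mem hx hy
    | single g c =>
      have h1 : proj p G U (ofGroupRing p G (MonoidAlgebra.single g c)) =
          MonoidAlgebra.single (g : G ⧸ (U : Subgroup G)) c := MonoidAlgebra.mapDomain_single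
      have h2 : s (MonoidAlgebra.single (g : G ⧸ (U : Subgroup G)) c) =
          scalar p G c * groupElt p G (g : G ⧸ (U : Subgroup G)).out :=
        MonoidAlgebra.liftNC_single _ _ _ _
      rw [h1, h2, ofGroupRing_single]
      set g' := (g : G ⧸ (U : Subgroup G)).out
      have h3 : g'⁻¹ * g ∈ U := QuotientGroup.eq.1 (Quotient.out_eq _)
      have h4 : scalar p G c * groupElt p G g - scalar p G c * groupElt p G g' =
          scalar p G c * groupElt p G g' * (groupElt p G (g'⁻¹ * g) - 1) := by
        rw [mul_sub, mul_one, mul_assoc, ← map_mul, mul_inv_cancel_left]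
      rw [h4]
      exact Ideal.mul_mem_left _ _ (groupElt_sub_one_mem h3)
  simpa [hz] using key z

theorem augIdeal_le_ker_proj (U : OpenSubgroup G) : augIdeal p U ≤ RingHom.ker (proj p G U) := by
  refine Ideal.span_le.2 ?_
  rintro _ ⟨u, hu, rfl⟩
  rw [SetLike.mem_coe, RingHom.mem_ker, map_sub, proj_groupElt, (QuotientGroup.eq_one_iff u).2 hu,
    map_one]
  exact sub_self _

/-- Elements of the abstract group ring are handled by coset representatives. A general x is
approximated by them at the levels U ⊓ V, and the augmentation ideal is closed because the compact
ring is Noetherian. -/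
theorem ker_proj [IsNoetherianRing (CompletedGroupAlgebra p G)] (U : OpenSubgroup G) :
    RingHom.ker (proj p G U) = augIdeal p U := by
  refine le_antisymm (fun x hx => ?_) (augIdeal_le_ker_proj U)
  refine mem_of_isClosed (IsNoetherianRing.isClosed_ideal (augIdeal p U)) fun V => ?_
  obtain ⟨z, hz⟩ := exists_proj_ofGroupRing_eq p G (U ⊓ V) (proj p G (U ⊓ V) x)
  refine ⟨ofGroupRing p G z, ofGroupRing_mem_augIdeal ?_, ?_⟩
  · rw [← proj_proj p G (inf_le_left : U ⊓ V ≤ U), hz, proj_proj, (RingHom.mem_ker).1 hx]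
  · rw [← proj_proj p G (inf_le_right : U ⊓ V ≤ V), hz, proj_proj]

/-- Powers of the augmentation ideal of a pro-`p` group tend to zero. -/
theorem exists_augIdeal_pow_le [IsNoetherianRing (CompletedGroupAlgebra p G)]
    (hG : ∀ (U : OpenSubgroup G) (g : G), ∃ k, g ^ p ^ k ∈ U) (V U : OpenSubgroup G) (n : ℕ) :
    ∃ k, augIdeal p V ^ k ≤ openIdeal p G U n := by
  refine Ideal.exists_pow_le_of_le_radical_of_fg (Ideal.span_le.2 ?_) (IsNoetherian.noetherian _)
  rintro _ ⟨g, -, rfl⟩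
  obtain ⟨k, hk⟩ := isNilpotent_mk_groupElt_sub_one hG U n g
  exact ⟨k, Ideal.Quotient.eq_zero_iff_mem.1 (by rw [map_pow, hk])⟩

end Augmentation

/-! ### Topological Nakayama lemma -/

section Nakayama

theorem exists_openAddSubgroup_subset {M : Type*} [AddCommGroup M] [TopologicalSpace M]
    [IsTopologicalAddGroup M] [CompactSpace M] [T2Space M] [TotallyDisconnectedSpace M]
    {W : Set M} (hW : W ∈ 𝓝 (0 : M)) : ∃ H : OpenAddSubgroup M, (H : Set M) ⊆ W := by
  obtain ⟨W', hW', ho, h0⟩ := mem_nhds_iff.1 hW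
  obtain ⟨C, hC, h0C, hCW⟩ := compact_exists_isClopen_in_isOpen ho h0
  obtain ⟨H, hH⟩ := IsTopologicalAddGroup.exist_openAddSubgroup_sub_clopen_nhds_of_zero hC h0C
  exact ⟨H, hH.trans (hCW.trans hW')⟩

theorem le_sup_pow_smul {A M : Type*} [CommRing A] [AddCommGroup M] [Module A M] {I : Ideal A}
    {N : Submodule A M} (h : N ⊔ I • ⊤ = ⊤) (k : ℕ) : N ⊔ I ^ k • (⊤ : Submodule A M) = ⊤ := by
  induction k with
  | zero => simp
  | succ k ih =>
    rw [eq_top_iff]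
    calc (⊤ : Submodule A M) = N ⊔ I ^ k • (N ⊔ I • ⊤) := by rw [h, ih]
      _ ≤ N ⊔ I ^ (k + 1) • ⊤ := by
        rw [Submodule.smul_sup, ← Submodule.mul_smul, ← pow_succ, ← sup_assoc]
        exact sup_le_sup_right (sup_le le_rfl Submodule.smul_le_right) _

variable {p : ℕ} [Fact p.Prime] {G : Type*} [CommGroup G] [TopologicalSpace G]
  [IsTopologicalGroup G] [CompactSpace G] {M : Type*} [AddCommGroup M]
  [Module (CompletedGroupAlgebra p G) M]

/-- Representatives of M_{U₀} span a submodule N with N + I^k M = M for all k. Since I^k tends to 0,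
N is dense; being finitely generated over a compact ring, it is also closed. -/
theorem IsProfiniteModule.finite [IsNoetherianRing (CompletedGroupAlgebra p G)]
    (hG : ∀ (U : OpenSubgroup G) (g : G), ∃ k, g ^ p ^ k ∈ U) (hM : IsProfiniteModule p G M)
    (U₀ : OpenSubgroup G) [Finite (Coinvariants p M U₀)] :
    Module.Finite (CompletedGroupAlgebra p G) M := by
  obtain ⟨_, _, _, _, _, _⟩ := hM
  let N : Submodule (CompletedGroupAlgebra p G) M :=
    Submodule.span _ (Set.range fun q : Coinvariants p M U₀ => q.out)
  have hNfg : N.FG := Submodule.fg_span (Set.finite_range _)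
  have hN : N ⊔ augIdeal p U₀ • ⊤ = ⊤ := by
    rw [eq_top_iff, ← coinvariantsKer_eq]
    intro m _
    have h1 : (Submodule.Quotient.mk m : Coinvariants p M U₀).out ∈ N :=
      Submodule.subset_span ⟨_, rfl⟩
    have h2 : m - (Submodule.Quotient.mk m : Coinvariants p M U₀).out ∈ coinvariantsKer p M U₀ := by
      rw [← Submodule.Quotient.eq]
      exact (Quotient.out_eq _).symm
    simpa using Submodule.add_mem_sup h1 h2
  suffices N = ⊤ from ⟨this ▸ hNfg⟩
  rw [eq_top_iff]
  intro m _
  have hcl : IsClosed (N : Set M) := (Submodule.isCompact_of_fg hNfg).isClosed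
  rw [← SetLike.mem_coe, ← hcl.closure_eq, mem_closure_iff_nhds]
  intro W hW
  have h0 : (fun w => m - w) ⁻¹' W ∈ 𝓝 (0 : M) :=
    (continuous_const.sub continuous_id).continuousAt.preimage_mem_nhds (by simpa using hW)
  obtain ⟨H, hH⟩ := exists_openAddSubgroup_subset h0
  -- Compactness of M makes continuity uniform: a neighbourhood u of 0 satisfies u • M ⊆ H, and H,
  -- being a subgroup, then contains I^k M.
  obtain ⟨u, v, hu, -, h0u, hv, huv⟩ := generalized_tube_lemma
    (isCompact_singleton (x := (0 : CompletedGroupAlgebra p G))) (isCompact_univ (X := M))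
    (H.isOpen.preimage (continuous_smul (M := CompletedGroupAlgebra p G) (X := M)))
    (by rintro ⟨x, m⟩ ⟨rfl, -⟩; simp)
  obtain ⟨U, n, hUn⟩ := exists_openIdeal_subset (hu.mem_nhds (h0u rfl))
  obtain ⟨k, hk⟩ := exists_augIdeal_pow_le hG U₀ U n
  have hm : m ∈ N ⊔ augIdeal p U₀ ^ k • (⊤ : Submodule _ M) := by
    rw [le_sup_pow_smul hN]
    trivial
  obtain ⟨a, ha, b, hb, rfl⟩ := Submodule.mem_sup.1 hm
  have hbH : b ∈ H := by
    refine Submodule.smul_induction_on hb (fun x hx y _ => ?_) fun _ _ => H.add_mem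
    exact huv (show (x, y) ∈ u ×ˢ v from ⟨hUn (hk hx), hv trivial⟩)
  exact ⟨a, by simpa using hH hbH, ha⟩

end Nakayama

/-! ### A uniformly nonsingular annihilator -/

section Annihilator

set_option linter.unusedSectionVars false

theorem det_neg_ne_zero_iff {R M : Type*} [CommRing R] [IsDomain R] [AddCommGroup M] [Module R M]
    [Module.Free R M] (f : Module.End R M) : LinearMap.det (-f) ≠ 0 ↔ LinearMap.det f ≠ 0 := by
  rw [← neg_one_smul R f, LinearMap.det_smul]
  exact ⟨right_ne_zero_of_mul, mul_ne_zero (pow_ne_zero _ (by simp))⟩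

/-- By Cayley–Hamilton x divides the constant term of its characteristic polynomial. That term is
the norm up to sign, hence a unit of ℤ_p times a power of p. -/
theorem exists_mul_eq_pow_of_norm_ne_zero {p : ℕ} [Fact p.Prime] {S : Type*} [CommRing S]
    [Algebra ℤ_[p] S] [Module.Free ℤ_[p] S] [Module.Finite ℤ_[p] S] {x : S}
    (hx : Algebra.norm ℤ_[p] x ≠ 0) : ∃ (t : S) (n : ℕ), t * x = (p : S) ^ n := by
  set P := (Algebra.lmul ℤ_[p] S x).charpoly
  have h1 : Polynomial.aeval x P = 0 := Algebra.aeval_self_charpoly_lmul x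
  have h2 : P.coeff 0 ≠ 0 := by
    rw [Polynomial.coeff_zero_eq_eval_zero, LinearMap.eval_charpoly, map_zero, zero_sub,
      det_neg_ne_zero_iff]
    exact hx
  rw [← Polynomial.divX_mul_X_add P, map_add, map_mul, Polynomial.aeval_X, Polynomial.aeval_C,
    PadicInt.unitCoeff_spec h2] at h1
  set u := PadicInt.unitCoeff h2
  set n := (P.coeff 0).valuation
  refine ⟨-algebraMap ℤ_[p] S (u⁻¹ : ℤ_[p]ˣ) * Polynomial.aeval x P.divX, n, ?_⟩
  have h3 : algebraMap ℤ_[p] S (u⁻¹ : ℤ_[p]ˣ) * algebraMap ℤ_[p] S (u : ℤ_[p]) = 1 := by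
    rw [← map_mul, Units.inv_mul, map_one]
  rw [map_mul, map_pow, map_natCast] at h1
  linear_combination -(algebraMap ℤ_[p] S (u⁻¹ : ℤ_[p]ˣ)) * h1 + (p : S) ^ n * h3

/-- Up to sign the norm is the characteristic polynomial of x at -p^k, and these distinct values
meet its finite set of roots only finitely often. -/
theorem norm_add_pow_ne_zero {p : ℕ} [Fact p.Prime] {S : Type*} [CommRing S]
    [Algebra ℤ_[p] S] [Module.Free ℤ_[p] S] [Module.Finite ℤ_[p] S] (x : S) :
    ∀ᶠ k : ℕ in atTop, Algebra.norm ℤ_[p] (x + (p : S) ^ k) ≠ 0 := by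
  set P := (Algebra.lmul ℤ_[p] S x).charpoly
  have hP : P ≠ 0 := (LinearMap.charpoly_monic _).ne_zero
  have hinj : Function.Injective fun k : ℕ => -(p : ℤ_[p]) ^ k := by
    intro k l h
    refine Nat.pow_right_injective (Fact.out : p.Prime).two_le ?_
    have h' := neg_injective h
    exact_mod_cast h'
  have hfin : {k : ℕ | P.eval (-(p : ℤ_[p]) ^ k) = 0}.Finite :=
    (P.rootSet_finite ℤ_[p]).preimage hinj.injOn |>.subset fun k hk => by
      simpa [Polynomial.mem_rootSet, hP] using hk
  have h1 : {k : ℕ | P.eval (-(p : ℤ_[p]) ^ k) = 0}ᶜ ∈ (atTop : Filter ℕ) :=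
    Nat.cofinite_eq_atTop ▸ hfin.compl_mem_cofinite
  filter_upwards [h1] with k hk
  have h2 : algebraMap ℤ_[p] (Module.End ℤ_[p] S) (-(p : ℤ_[p]) ^ k) - Algebra.lmul ℤ_[p] S x =
      -Algebra.lmul ℤ_[p] S (x + (p : S) ^ k) := by
    rw [map_add, map_neg, map_pow, map_pow, map_natCast, map_natCast]
    abel
  rw [Set.mem_compl_iff, Set.mem_ofPred_eq, LinearMap.eval_charpoly, h2] at hk
  exact (det_neg_ne_zero_iff _).1 hk

variable {p : ℕ} [Fact p.Prime] {G : Type*} [CommGroup G] [TopologicalSpace G]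
  [IsTopologicalGroup G] [CompactSpace G]

theorem continuous_norm_proj (U : OpenSubgroup G) :
    Continuous fun x : CompletedGroupAlgebra p G => Algebra.norm ℤ_[p] (proj p G U x) := by
  classical
  simp only [Algebra.norm_eq_matrix_det (MonoidAlgebra.basis (G ⧸ (U : Subgroup G)) ℤ_[p])]
  refine Continuous.matrix_det (continuous_matrix fun i j => ?_)
  simp only [Algebra.leftMulMatrix_eq_repr_mul, MonoidAlgebra.basis_apply]
  have h : ∀ x : CompletedGroupAlgebra p G,
      (MonoidAlgebra.basis (G ⧸ (U : Subgroup G)) ℤ_[p]).repr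
        (proj p G U x * MonoidAlgebra.single j 1) i = (proj p G U x).coeff (i * j⁻¹) := fun x => by
    change (proj p G U x * MonoidAlgebra.single j 1).coeff i = _
    rw [MonoidAlgebra.coeff_mul_single_apply, mul_one]
  simp only [h]
  exact continuous_coeff_proj p G U _

instance (U : OpenSubgroup G) :
    Module.Finite ℤ_[p] (MonoidAlgebra ℤ_[p] (G ⧸ (U : Subgroup G))) :=
  Module.Finite.of_basis (MonoidAlgebra.basis (G ⧸ (U : Subgroup G)) ℤ_[p])

instance (U : OpenSubgroup G) :
    Module.Free ℤ_[p] (MonoidAlgebra ℤ_[p] (G ⧸ (U : Subgroup G))) :=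
  Module.Free.of_basis (MonoidAlgebra.basis (G ⧸ (U : Subgroup G)) ℤ_[p])

variable {M : Type*} [AddCommGroup M] [Module (CompletedGroupAlgebra p G) M]

theorem exists_pow_smul_mem_coinvariantsKer (U : OpenSubgroup G) [Finite (Coinvariants p M U)] :
    ∃ a : ℕ, ∀ m : M, (p : CompletedGroupAlgebra p G) ^ a • m ∈ coinvariantsKer p M U := by
  set c : ℤ_[p] := ((Nat.card (Coinvariants p M U) : ℕ) : ℤ_[p])
  have hc : c ≠ 0 := Nat.cast_ne_zero.2 Nat.card_pos.ne'
  refine ⟨c.valuation, fun m => ?_⟩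
  rw [← Submodule.Quotient.mk_eq_zero, Submodule.Quotient.mk_smul]
  set q : Coinvariants p M U := Submodule.Quotient.mk m
  have h1 : scalar p G c • q = 0 := by
    rw [map_natCast, Nat.cast_smul_eq_nsmul]
    exact card_nsmul_eq_zero'
  rw [PadicInt.unitCoeff_spec hc, map_mul, map_pow, map_natCast, mul_smul] at h1
  have h2 : scalar p G ((PadicInt.unitCoeff hc)⁻¹ : ℤ_[p]ˣ) • scalar p G (PadicInt.unitCoeff hc) •
      (p : CompletedGroupAlgebra p G) ^ c.valuation • q = 0 := by
    rw [h1, smul_zero]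
  rwa [smul_smul, ← map_mul, Units.inv_mul, map_one, one_smul] at h2

/-- The annihilator of a systematically coinvariant-finite module contains, at every finite level,
a power of `p`. -/
theorem exists_annihilator_proj_eq_pow [Module.Finite (CompletedGroupAlgebra p G) M]
    (U : OpenSubgroup G) [Finite (Coinvariants p M U)] :
    ∃ t ∈ Module.annihilator (CompletedGroupAlgebra p G) M, ∃ a : ℕ, proj p G U t = (p : _) ^ a := by
  obtain ⟨a, ha⟩ := exists_pow_smul_mem_coinvariantsKer (p := p) (M := M) U
  set f : Module.End (CompletedGroupAlgebra p G) M := algebraMap _ _ ((p : CompletedGroupAlgebra p G) ^ a)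
  have hf : LinearMap.range f ≤ augIdeal p U • ⊤ := by
    rintro _ ⟨m, rfl⟩
    rw [← coinvariantsKer_eq]
    exact ha m
  -- Cayley–Hamilton for multiplication by p^a, whose image lies in I M: the lower coefficients of P
  -- lie in powers of I and vanish at level U, so P(p^a) kills M and projects to p^(a deg P).
  obtain ⟨P, hP, -, hcoeff, h0⟩ :=
    LinearMap.exists_monic_and_natDegree_eq_and_coeff_mem_pow_and_aeval_eq_zero _ f _ hf
  rw [Polynomial.aeval_algebraMap_apply, Polynomial.coe_aeval_eq_eval] at h0
  refine ⟨P.eval ((p : CompletedGroupAlgebra p G) ^ a), ?_, a * P.natDegree, ?_⟩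
  · rw [Module.mem_annihilator]
    exact fun m => LinearMap.congr_fun h0 m
  · have hmap : P.map (proj p G U) = Polynomial.X ^ P.natDegree := by
      refine Polynomial.ext fun k => ?_
      rw [Polynomial.coeff_map, Polynomial.coeff_X_pow]
      rcases lt_trichotomy k P.natDegree with hk | rfl | hk
      · rw [if_neg hk.ne]
        exact augIdeal_le_ker_proj U (Ideal.pow_le_self (Nat.sub_pos_of_lt hk).ne' (hcoeff k))
      · rw [if_pos rfl, hP.coeff_natDegree, map_one]
      · rw [if_neg hk.ne', Polynomial.coeff_eq_zero_of_natDegree_lt hk, map_zero]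
    rw [← Polynomial.eval_map_apply, hmap, Polynomial.eval_pow, Polynomial.eval_X, map_pow,
      map_natCast, pow_mul]

/-- A finitely generated systematically coinvariant-finite module is killed by an element which is
a nonzerodivisor at every finite level. -/
theorem exists_annihilator_forall_dvd_pow [IsNoetherianRing (CompletedGroupAlgebra p G)]
    [Countable (OpenSubgroup G)] [Module.Finite (CompletedGroupAlgebra p G) M]
    (hfin : SystematicallyCoinvariantFinite (G := G) p M) :
    ∃ s : CompletedGroupAlgebra p G, (∀ m : M, s • m = 0) ∧
      ∀ U : OpenSubgroup G, ∃ t n, t * proj p G U s = (p : _) ^ n := by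
  let J := Module.annihilator (CompletedGroupAlgebra p G) M
  have hJ : IsClosed (J : Set (CompletedGroupAlgebra p G)) := IsNoetherianRing.isClosed_ideal J
  have : CompactSpace J := isCompact_iff_compactSpace.1 hJ.isCompact
  -- Baire's theorem is applied in the compact Hausdorff annihilator J to the sets where the norm at
  -- level U is nonzero.
  let O : OpenSubgroup G → Set J := fun U => {s | Algebra.norm ℤ_[p] (proj p G U s) ≠ 0}
  have hO : ∀ U, IsOpen (O U) := fun U =>
    isOpen_ne.preimage ((continuous_norm_proj U).comp continuous_subtype_val)
  have hd : ∀ U, Dense (O U) := by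
    intro U s
    have := hfin U
    obtain ⟨t, ht, a, hta⟩ := exists_annihilator_proj_eq_pow (p := p) (M := M) U
    -- Perturbing s by p^k t, with t projecting to p^a at level U, stays in J, tends to s and adds
    -- p^(k+a) at that level. The norm is then nonzero for large k.
    let f : ℕ → J := fun k => s + (p : CompletedGroupAlgebra p G) ^ k • (⟨t, ht⟩ : J)
    have hf : Tendsto f atTop (𝓝 s) := by
      rw [tendsto_subtype_rng]
      have h1 : Tendsto (fun k : ℕ => (p : CompletedGroupAlgebra p G) ^ k * t) atTop (𝓝 0) := by
        refine hasBasis_openIdeal.tendsto_right_iff.2 fun ⟨V, n⟩ _ => ?_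
        filter_upwards [eventually_ge_atTop n] with k hk
        refine Ideal.mul_mem_right _ _ ?_
        rw [← Nat.sub_add_cancel hk, pow_add]
        exact Ideal.mul_mem_left _ _ (natCast_pow_mem_openIdeal V n)
      simpa [f] using h1.const_add (s : CompletedGroupAlgebra p G)
    refine mem_closure_of_tendsto hf ?_
    filter_upwards [(tendsto_add_atTop_nat a).eventually (norm_add_pow_ne_zero (p := p) (proj p G U s))]
      with k hk
    have h2 : proj p G U (f k) = proj p G U s + (p : _) ^ (k + a) := by
      simp only [f, Submodule.coe_add, Submodule.coe_smul, smul_eq_mul, map_add, map_mul, map_pow,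
        map_natCast, hta, pow_add]
    change Algebra.norm ℤ_[p] (proj p G U (f k)) ≠ 0
    rwa [h2]
  obtain ⟨s, hs⟩ := (dense_iInter_of_isOpen hO hd).nonempty
  exact ⟨s, fun m => Module.mem_annihilator.1 s.2 m, fun U =>
    exists_mul_eq_pow_of_norm_ne_zero (Set.mem_iInter.1 hs U)⟩

end Annihilator

end Iwasawa

end


noncomputable section

namespace Iwasawa

open Filter Topology

/-! ### The characters `ℤ_p → ℤ/p^n → ℚ/ℤ` -/

section PadicChar

/-- The character `a ↦ a / p^n` of `ℤ_p`. -/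
def padicChar (p : ℕ) [Fact p.Prime] (n : ℕ) : ℤ_[p] →+ AddCircle (1 : ℚ) :=
  (ZMod.lift (p ^ n) ⟨zmultiplesHom _ (((1 : ℚ) / (p ^ n : ℕ) : ℚ) : AddCircle (1 : ℚ)), by
    have hp : ((p ^ n : ℕ) : ℚ) ≠ 0 := by
      exact_mod_cast pow_ne_zero _ (Fact.out : p.Prime).ne_zero
    rw [zmultiplesHom_apply, natCast_zsmul, ← AddCircle.coe_nsmul, nsmul_eq_mul,
      mul_one_div_cancel hp]
    exact AddCircle.coe_period 1⟩).comp (PadicInt.toZModPow n).toAddMonoidHom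

variable {p : ℕ} [Fact p.Prime]

theorem padicChar_intCast (n : ℕ) (k : ℤ) :
    padicChar p n k = (((k : ℚ) / (p ^ n : ℕ) : ℚ) : AddCircle (1 : ℚ)) := by
  simp only [padicChar, AddMonoidHom.comp_apply, RingHom.toAddMonoidHom_eq_coe,
    AddMonoidHom.coe_coe, map_intCast, ZMod.lift_coe]
  rw [zmultiplesHom_apply, ← AddCircle.coe_zsmul, zsmul_eq_mul, mul_one_div]

theorem padicChar_pow_mul (n : ℕ) (x : ℤ_[p]) : padicChar p n ((p : ℤ_[p]) ^ n * x) = 0 := by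
  have : PadicInt.toZModPow n ((p : ℤ_[p]) ^ n * x) = 0 := by
    rw [← RingHom.mem_ker, PadicInt.ker_toZModPow, Ideal.mem_span_singleton]
    exact dvd_mul_right _ _
  simp [padicChar, this]

theorem exists_eq_natCast_add (n : ℕ) (x : ℤ_[p]) : ∃ (k : ℕ) (y : ℤ_[p]), x = k + p ^ n * y := by
  obtain ⟨y, hy⟩ := Ideal.mem_span_singleton.1 (PadicInt.appr_spec n x)
  exact ⟨x.appr n, y, by rw [← hy]; ring⟩

theorem padicChar_eq_zero_iff {n : ℕ} {x : ℤ_[p]} : padicChar p n x = 0 ↔ (p : ℤ_[p]) ^ n ∣ x := by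
  constructor
  · obtain ⟨k, y, rfl⟩ := exists_eq_natCast_add n x
    rw [map_add, padicChar_pow_mul, add_zero, ← Int.cast_natCast, padicChar_intCast,
      AddCircle.coe_eq_zero_iff]
    rintro ⟨m, hm⟩
    have hp : ((p ^ n : ℕ) : ℚ) ≠ 0 := by
      exact_mod_cast pow_ne_zero _ (Fact.out : p.Prime).ne_zero
    rw [eq_div_iff hp, zsmul_eq_mul, mul_one] at hm
    have hm' : (k : ℤ) = m * (p ^ n : ℕ) := by exact_mod_cast hm.symm
    rw [hm']
    push_cast
    exact dvd_add (dvd_mul_left _ _) (dvd_mul_right _ _)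
  · rintro ⟨y, rfl⟩
    exact padicChar_pow_mul n y

theorem padicChar_add_pow_mul (n k : ℕ) (x : ℤ_[p]) :
    padicChar p (n + k) ((p : ℤ_[p]) ^ k * x) = padicChar p n x := by
  obtain ⟨j, y, rfl⟩ := exists_eq_natCast_add n x
  have h1 : (p : ℤ_[p]) ^ k * (j + p ^ n * y) = ((p ^ k * j : ℤ) : ℤ_[p]) + p ^ (n + k) * y := by
    push_cast
    ring
  have h2 : ((j : ℤ) : ℤ_[p]) = j := Int.cast_natCast j
  rw [h1, map_add, map_add, padicChar_pow_mul, padicChar_pow_mul, ← h2,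
    padicChar_intCast, padicChar_intCast]
  have hp : (p : ℚ) ≠ 0 := by exact_mod_cast (Fact.out : p.Prime).ne_zero
  congr 2
  push_cast
  field_simp
  ring

theorem exists_padicChar_eq {n : ℕ} {z : AddCircle (1 : ℚ)} (hz : p ^ n • z = 0) :
    ∃ a, padicChar p n a = z := by
  obtain ⟨q, rfl⟩ := QuotientAddGroup.mk_surjective z
  change p ^ n • (q : AddCircle (1 : ℚ)) = 0 at hz
  rw [← AddCircle.coe_nsmul, AddCircle.coe_eq_zero_iff] at hz
  obtain ⟨m, hm⟩ := hz
  have hp : ((p ^ n : ℕ) : ℚ) ≠ 0 := by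
    exact_mod_cast pow_ne_zero _ (Fact.out : p.Prime).ne_zero
  refine ⟨m, ?_⟩
  rw [padicChar_intCast]
  change _ = (q : AddCircle (1 : ℚ))
  congr 1
  rw [div_eq_iff hp]
  rw [zsmul_eq_mul, mul_one, nsmul_eq_mul] at hm
  rw [hm, mul_comm]

/-- `padicChar` is compatible with the `ℤ_p`-action on any `p^n`-torsion value. -/
theorem padicChar_mul (n : ℕ) (c a : ℤ_[p]) {k : ℕ} {y : ℤ_[p]} (hc : c = k + p ^ n * y) :
    padicChar p n (c * a) = k • padicChar p n a := by
  rw [hc, add_mul, map_add, mul_assoc, padicChar_pow_mul, add_zero, ← nsmul_eq_mul, map_nsmul]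

end PadicChar

/-! ### The trace characters of finite group rings -/

section TraceChar

set_option linter.unusedSectionVars false

variable {p : ℕ} [Fact p.Prime] {H : Type*} [CommGroup H] [Fintype H]

/-- The character `x ↦ c₁(t x) / p^n` of `ℤ_p[H]`, where `c₁` is the coefficient at `1`. -/
def traceChar (n : ℕ) (t : MonoidAlgebra ℤ_[p] H) : MonoidAlgebra ℤ_[p] H →+ AddCircle (1 : ℚ) where
  toFun x := padicChar p n ((t * x).coeff 1)
  map_zero' := by simp
  map_add' x y := by simp [mul_add]

theorem traceChar_apply (n : ℕ) (t x : MonoidAlgebra ℤ_[p] H) :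
    traceChar n t x = padicChar p n ((t * x).coeff 1) := rfl

theorem coeff_natCast_pow_mul (n : ℕ) (x : MonoidAlgebra ℤ_[p] H) (h : H) :
    ((p : MonoidAlgebra ℤ_[p] H) ^ n * x).coeff h = (p : ℤ_[p]) ^ n * x.coeff h := by
  rw [← Nat.cast_pow, ← Nat.cast_pow, ← nsmul_eq_mul, ← nsmul_eq_mul, MonoidAlgebra.coeff_smul_apply]

theorem natCast_pow_mul_cancel {n : ℕ} {x y : MonoidAlgebra ℤ_[p] H}
    (h : (p : MonoidAlgebra ℤ_[p] H) ^ n * x = (p : MonoidAlgebra ℤ_[p] H) ^ n * y) : x = y := by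
  refine MonoidAlgebra.coeff_injective (Finsupp.ext fun q => ?_)
  have h1 := congrArg (fun z => MonoidAlgebra.coeff z q) h
  simp only [coeff_natCast_pow_mul] at h1
  exact mul_left_cancel₀ (pow_ne_zero _ (PadicInt.prime_p (p := p)).ne_zero) h1

theorem exists_eq_natCast_pow_mul {n : ℕ} {x : MonoidAlgebra ℤ_[p] H}
    (h : ∀ q, (p : ℤ_[p]) ^ n ∣ x.coeff q) : ∃ y, x = (p : MonoidAlgebra ℤ_[p] H) ^ n * y := by
  choose c hc using h
  refine ⟨.ofCoeff (Finsupp.equivFunOnFinite.symm c), ?_⟩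
  refine MonoidAlgebra.coeff_injective (Finsupp.ext fun q => ?_)
  rw [coeff_natCast_pow_mul, hc]
  rfl

/-- Both sides are the coefficient at 1 of x/s modulo ℤ_p: since ts = p^n and t's = p^n', one has
p^n' t = p^n t'. -/
theorem traceChar_eq_of_mul_eq {n n' : ℕ} {t t' s : MonoidAlgebra ℤ_[p] H}
    (h : t * s = (p : _) ^ n) (h' : t' * s = (p : _) ^ n') (x : MonoidAlgebra ℤ_[p] H) :
    traceChar n t x = traceChar n' t' x := by
  have h1 : (p : MonoidAlgebra ℤ_[p] H) ^ n' * (t * x) = (p : MonoidAlgebra ℤ_[p] H) ^ n * (t' * x) := by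
    rw [← h, ← h']
    ring
  have h2 := congrArg (fun z => MonoidAlgebra.coeff z 1) h1
  simp only [coeff_natCast_pow_mul] at h2
  rw [traceChar_apply, traceChar_apply, ← padicChar_add_pow_mul n n', h2, add_comm,
    padicChar_add_pow_mul]

theorem traceChar_mul_self {n : ℕ} {t s : MonoidAlgebra ℤ_[p] H} (h : t * s = (p : _) ^ n)
    (x : MonoidAlgebra ℤ_[p] H) : traceChar n t (s * x) = 0 := by
  rw [traceChar_apply, ← mul_assoc, h, coeff_natCast_pow_mul, padicChar_pow_mul]

theorem coeff_single_mul_one (x : MonoidAlgebra ℤ_[p] H) (q : H) :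
    (MonoidAlgebra.single q⁻¹ 1 * x).coeff 1 = x.coeff q := by
  rw [MonoidAlgebra.coeff_single_mul_apply, inv_inv, mul_one, one_mul]

/-- The trace character induces a perfect pairing on `ℤ_p[H]/s`. -/
theorem exists_eq_mul_of_traceChar_eq_zero {n : ℕ} {t s y : MonoidAlgebra ℤ_[p] H}
    (h : t * s = (p : _) ^ n)
    (hy : ∀ q : H, traceChar n t (MonoidAlgebra.single q 1 * y) = 0) : ∃ w, y = s * w := by
  have h1 : ∀ q, (p : ℤ_[p]) ^ n ∣ (t * y).coeff q := by
    intro q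
    rw [← padicChar_eq_zero_iff, ← coeff_single_mul_one, mul_left_comm]
    exact hy q⁻¹
  obtain ⟨w, hw⟩ := exists_eq_natCast_pow_mul h1
  refine ⟨w, natCast_pow_mul_cancel (n := n) ?_⟩
  rw [mul_left_comm, ← hw, ← h]
  ring

end TraceChar

end Iwasawa

end


noncomputable section

namespace Iwasawa

open Filter Topology

/-! ### Characters of the direct limit of the coinvariants -/

section LimitCharacters

set_option linter.unusedSectionVars false

variable {p : ℕ} [Fact p.Prime] {G : Type*} [CommGroup G] [TopologicalSpace G]
  [IsTopologicalGroup G] [CompactSpace G]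

instance (U V : OpenSubgroup G) : Fintype (relQuotient U V) := Fintype.ofFinite _

variable (p) in
/-- A lift of the norm element `∑_{τ ∈ U/V} τ` to `ℤ_p⟦G⟧`. -/
def normElt (U V : OpenSubgroup G) : CompletedGroupAlgebra p G :=
  ∑ τ : relQuotient U V, groupElt p G τ.1.out

theorem proj_normElt (U V : OpenSubgroup G) :
    proj p G V (normElt p U V) = ∑ τ : relQuotient U V, MonoidAlgebra.single τ.1 1 := by
  rw [normElt, map_sum]
  refine Finset.sum_congr rfl fun τ _ => ?_
  rw [proj_groupElt]
  exact congrArg (fun q => MonoidAlgebra.single q (1 : ℤ_[p])) (Quotient.out_eq τ.1)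

/-- The coefficient at `1` of `N_{U/V} y` is that of the image of `y` at level `U`. -/
theorem coeff_normElt_mul {U V : OpenSubgroup G} (h : V ≤ U)
    (y : MonoidAlgebra ℤ_[p] (G ⧸ (V : Subgroup G))) :
    (proj p G V (normElt p U V) * y).coeff 1 = (groupRingProj p G h y).coeff 1 := by
  classical
  have hmem : ∀ b : G ⧸ (V : Subgroup G), QuotientGroup.map (V : Subgroup G) (U : Subgroup G)
      (MonoidHom.id G) (fun _ hx => h hx) b = 1 ↔ b ∈ relQuotient U V := by
    intro b
    obtain ⟨g, rfl⟩ := QuotientGroup.mk_surjective b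
    change (g : G ⧸ (U : Subgroup G)) = 1 ↔ _
    rw [QuotientGroup.eq_one_iff]
    constructor
    · exact fun hg => ⟨g, hg, rfl⟩
    · rintro ⟨g', hg', he⟩
      have h1 : g'⁻¹ * g ∈ V := QuotientGroup.eq.1 he
      have := mul_mem hg' (h h1 : g'⁻¹ * g ∈ (U : Subgroup G))
      rwa [mul_inv_cancel_left] at this
  rw [groupRingProj, coeff_mapDomainRingHom, proj_normElt, Finset.sum_mul, MonoidAlgebra.coeff_sum,
    Finsupp.finsetSum_apply]
  simp only [MonoidAlgebra.coeff_single_mul_apply, one_mul, mul_one, hmem]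
  rw [← Finset.sum_filter, Finset.sum_subtype (p := (· ∈ relQuotient U V)) _ (by simp)]
  exact Fintype.sum_equiv (Equiv.inv _) _ _ fun τ => rfl

variable {M : Type*} [AddCommGroup M] [Module (CompletedGroupAlgebra p G) M]

theorem normMap_mk (U V : OpenSubgroup G) (m : M) :
    normMap p M U V ((coinvariantsKer p M U).mkQ m) =
      (coinvariantsKer p M V).mkQ (normElt p U V • m) := by
  have h1 : normMap p M U V ((coinvariantsKer p M U).mkQ m) =
      normEnd p M U V ((coinvariantsKer p M V).mkQ m) := rfl
  rw [h1, normEnd, finsum_eq_sum_of_fintype, LinearMap.sum_apply, normElt, Finset.sum_smul, map_sum]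
  refine Finset.sum_congr rfl fun τ _ => ?_
  rw [map_smul]
  conv_lhs => rw [← Quotient.out_eq τ.1]
  rfl

variable (M) in
/-- The map `M_U → lim M_U`. -/
def coinvariantsToLimit (U : OpenSubgroup G) :
    Coinvariants p M U →ₗ[CompletedGroupAlgebra p G] CoinvariantsLimit (G := G) p M := by
  classical
  exact Module.DirectLimit.of (CompletedGroupAlgebra p G) (OpenSubgroup G)ᵒᵈ
    (fun U : (OpenSubgroup G)ᵒᵈ => Coinvariants p M (OrderDual.ofDual U))
    (fun U V _ => normMap p M (OrderDual.ofDual U) (OrderDual.ofDual V)) (OrderDual.toDual U)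

/-- The image in `lim M_U` of the class of `m` in `M_U`. -/
def toLimit (U : OpenSubgroup G) :
    M →ₗ[CompletedGroupAlgebra p G] CoinvariantsLimit (G := G) p M :=
  (coinvariantsToLimit M U).comp (coinvariantsKer p M U).mkQ

theorem toLimit_normElt_smul {U V : OpenSubgroup G} (h : V ≤ U) (m : M) :
    toLimit (p := p) V (normElt p U V • m) = toLimit U m := by
  classical
  rw [toLimit, LinearMap.comp_apply, ← normMap_mk]
  exact Module.DirectLimit.of_f (G := fun U : (OpenSubgroup G)ᵒᵈ =>
    Coinvariants p M (OrderDual.ofDual U))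
    (f := fun U V _ => normMap p M (OrderDual.ofDual U) (OrderDual.ofDual V))
    (hij := (show OrderDual.toDual U ≤ OrderDual.toDual V from h))

theorem toLimit_eq_zero_of_mem (U : OpenSubgroup G) {m : M} (hm : m ∈ coinvariantsKer p M U) :
    toLimit (p := p) U m = 0 := by
  rw [toLimit, LinearMap.comp_apply, Submodule.mkQ_apply, (Submodule.Quotient.mk_eq_zero _).2 hm,
    map_zero]

theorem exists_toLimit_eq (z : CoinvariantsLimit (G := G) p M) :
    ∃ (U : OpenSubgroup G) (m : M), toLimit U m = z := by
  classical
  obtain ⟨U, q, rfl⟩ := Module.DirectLimit.exists_of z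
  obtain ⟨m, rfl⟩ := (coinvariantsKer p M (OrderDual.ofDual U)).mkQ_surjective q
  exact ⟨OrderDual.ofDual U, m, rfl⟩

/-- A compatible family of characters of the coinvariants defines a character of the limit. -/
theorem exists_character_limit (χ : OpenSubgroup G → CharacterModule M)
    (h0 : ∀ U, ∀ m ∈ coinvariantsKer p M U, χ U m = 0)
    (hN : ∀ U V, V ≤ U → ∀ m, χ V (normElt p U V • m) = χ U m) :
    ∃ ξ : CharacterModule (CoinvariantsLimit (G := G) p M), ∀ U m, ξ (toLimit U m) = χ U m := by
  classical
  let A := CompletedGroupAlgebra p G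
  -- The limit is universal for ℤ_p⟦G⟧-linear maps, so χ is replaced by the linear map m ↦ (x ↦ χ(x
  -- m)); evaluation at 1 recovers χ.
  let F : ∀ U : OpenSubgroup G, M →ₗ[A] CharacterModule A := fun U =>
    { toFun m := (χ U).comp ((LinearMap.toSpanSingleton A M m).toAddMonoidHom)
      map_add' m m' := by
        ext x
        change χ U (x • (m + m')) = χ U (x • m) + χ U (x • m')
        rw [smul_add, map_add]
      map_smul' a m := by
        ext x
        change χ U (x • a • m) = χ U ((a • x) • m)
        rw [smul_eq_mul, mul_comm, mul_smul] }
  have hF : ∀ U m (x : A), F U m x = χ U (x • m) := fun U m x => rfl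
  let F' : ∀ U : OpenSubgroup G, Coinvariants p M U →ₗ[A] CharacterModule A := fun U =>
    (coinvariantsKer p M U).liftQ (F U) fun m hm => by
      rw [LinearMap.mem_ker]
      ext x
      rw [hF]
      exact h0 U _ (Submodule.smul_mem _ _ hm)
  let L := Module.DirectLimit.lift A (OpenSubgroup G)ᵒᵈ
    (fun U : (OpenSubgroup G)ᵒᵈ => Coinvariants p M (OrderDual.ofDual U))
    (fun U V _ => normMap p M (OrderDual.ofDual U) (OrderDual.ofDual V))
    (fun U => F' (OrderDual.ofDual U)) (by
      intro U V hUV q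
      obtain ⟨m, rfl⟩ := (coinvariantsKer p M (OrderDual.ofDual U)).mkQ_surjective q
      rw [normMap_mk]
      ext x
      change χ _ (x • normElt p _ _ • m) = χ _ (x • m)
      rw [smul_comm]
      exact hN _ _ hUV _)
  refine ⟨{ toFun z := L z 1
            map_zero' := by rw [map_zero]; rfl
            map_add' z z' := by rw [map_add]; rfl }, fun U m => ?_⟩
  have h1 : L (toLimit U m) = F U m := Module.DirectLimit.lift_of (R := A)
    (G := fun U : (OpenSubgroup G)ᵒᵈ => Coinvariants p M (OrderDual.ofDual U))
    (f := fun U V _ => normMap p M (OrderDual.ofDual U) (OrderDual.ofDual V)) _ _ _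
  change L (toLimit U m) 1 = _
  rw [h1, hF, one_smul]

end LimitCharacters

end Iwasawa

end


noncomputable section

namespace Iwasawa

open Filter Topology

/-! ### Duality between `Hom(M, ℤ_p⟦G⟧/s)` and the dual of `lim M_U` -/

section Duality

set_option linter.unusedSectionVars false

variable {p : ℕ} [Fact p.Prime] {G : Type*} [CommGroup G] [TopologicalSpace G]
  [IsTopologicalGroup G] [CompactSpace G]

/-- The trace character of level `U`, as a character of `ℤ_p⟦G⟧`. -/
def levelChar (n : OpenSubgroup G → ℕ) (t : ∀ U : OpenSubgroup G, MonoidAlgebra ℤ_[p] (G ⧸ (U : Subgroup G)))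
    (U : OpenSubgroup G) : CompletedGroupAlgebra p G →+ AddCircle (1 : ℚ) :=
  (traceChar (n U) (t U)).comp (proj p G U).toAddMonoidHom

variable {s : CompletedGroupAlgebra p G} {n : OpenSubgroup G → ℕ}
  {t : ∀ U : OpenSubgroup G, MonoidAlgebra ℤ_[p] (G ⧸ (U : Subgroup G))}

theorem levelChar_apply (U : OpenSubgroup G) (x : CompletedGroupAlgebra p G) :
    levelChar n t U x = padicChar p (n U) ((t U * proj p G U x).coeff 1) := rfl

theorem levelChar_eq_zero_of_mem_augIdeal {U : OpenSubgroup G} {x : CompletedGroupAlgebra p G}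
    (hx : x ∈ augIdeal p U) : levelChar n t U x = 0 := by
  rw [levelChar_apply, (RingHom.mem_ker).1 (augIdeal_le_ker_proj U hx), mul_zero]
  exact map_zero _

theorem isLocallyConstant_levelChar (U : OpenSubgroup G) : IsLocallyConstant (levelChar n t U) := by
  refine (IsLocallyConstant.iff_eventually_eq _).2 fun x => ?_
  have h1 : Tendsto (fun y => y - x) (𝓝 x) (𝓝 0) := by
    simpa using (continuous_sub_right x).tendsto x
  filter_upwards [h1 ((isOpen_openIdeal U (n U)).mem_nhds (zero_mem _))] with y hy
  rw [← sub_eq_zero, ← map_sub, levelChar_apply]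
  obtain ⟨z, hz⟩ := exists_eq_natCast_pow_mul (mem_openIdeal.1 hy)
  rw [hz, mul_left_comm, coeff_natCast_pow_mul, padicChar_pow_mul]

section

variable (ht : ∀ U, t U * proj p G U s = (p : _) ^ n U)
include ht

theorem levelChar_mul_self (U : OpenSubgroup G) (x : CompletedGroupAlgebra p G) :
    levelChar n t U (s * x) = 0 := by
  have := traceChar_mul_self (ht U) (proj p G U x)
  rwa [← map_mul] at this

/-- The image of t_V at level U is another cofactor of s_U, with exponent n V, so it defines the
same trace character. Multiplication by the norm element turns the coefficient at 1 at level V into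
the one at level U. -/
theorem levelChar_normElt_mul {U V : OpenSubgroup G} (h : V ≤ U) (x : CompletedGroupAlgebra p G) :
    levelChar n t V (normElt p U V * x) = levelChar n t U x := by
  have h1 : groupRingProj p G h (t V) * proj p G U s = (p : _) ^ n V := by
    rw [← proj_proj p G h s, ← map_mul, ht, map_pow, map_natCast]
  have h2 := traceChar_eq_of_mul_eq (ht U) h1 (proj p G U x)
  change _ = traceChar (n U) (t U) (proj p G U x)
  rw [h2, levelChar_apply, map_mul, mul_left_comm, coeff_normElt_mul h, map_mul, proj_proj]
  rfl

/-- Perfectness of the trace pairing gives divisibility by s at each finite level, and the ideal (s)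
is closed. -/
theorem mem_span_of_levelChar_eq_zero [IsNoetherianRing (CompletedGroupAlgebra p G)]
    {y : CompletedGroupAlgebra p G} (hy : ∀ U x, levelChar n t U (x * y) = 0) :
    y ∈ Ideal.span {s} := by
  refine mem_of_isClosed (IsNoetherianRing.isClosed_ideal (Ideal.span {s})) fun U => ?_
  obtain ⟨w, hw⟩ := exists_eq_mul_of_traceChar_eq_zero (ht U) (y := proj p G U y) fun q => by
    obtain ⟨x, hx⟩ := proj_surjective p G U (MonoidAlgebra.single q 1)
    rw [← hx, ← map_mul]
    exact hy U x
  obtain ⟨z, rfl⟩ := proj_surjective p G U w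
  exact ⟨s * z, Ideal.mul_mem_right _ _ (Ideal.mem_span_singleton_self s), by rw [map_mul, hw]⟩

theorem levelChar_eq_of_mk_eq (U : OpenSubgroup G) {x y : CompletedGroupAlgebra p G}
    (h : Ideal.Quotient.mk (Ideal.span {s}) x = Ideal.Quotient.mk _ y) :
    levelChar n t U x = levelChar n t U y := by
  obtain ⟨z, hz⟩ := Ideal.mem_span_singleton.1 (Ideal.Quotient.eq.1 h)
  rw [← sub_eq_zero, ← map_sub, hz, levelChar_mul_self ht]

/-- Every character of level `U` killed by `s` is represented by an element. -/
theorem exists_levelChar_mul_eq [IsNoetherianRing (CompletedGroupAlgebra p G)] (U : OpenSubgroup G)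
    (χ : CompletedGroupAlgebra p G →+ AddCircle (1 : ℚ)) (hU : ∀ x ∈ augIdeal p U, χ x = 0)
    (hs : ∀ x, χ (s * x) = 0) : ∃ y, ∀ x, levelChar n t U (x * y) = χ x := by
  have hproj : ∀ x x', proj p G U x = proj p G U x' → χ x = χ x' := by
    intro x x' h
    rw [← sub_eq_zero, ← map_sub]
    refine hU _ ?_
    rw [← ker_proj, RingHom.mem_ker, map_sub, h, sub_self]
  obtain ⟨t', ht'⟩ := proj_surjective p G U (t U)
  have hpow : ∀ x, χ ((p : CompletedGroupAlgebra p G) ^ n U * x) = 0 := by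
    intro x
    rw [hproj _ (s * (t' * x)), hs]
    rw [map_mul, map_mul, map_mul, ht', mul_left_comm, ← mul_assoc, ht, map_pow, map_natCast]
  have hex : ∀ q : G ⧸ (U : Subgroup G), ∃ a, padicChar p (n U) a = χ (groupElt p G q⁻¹.out) := by
    intro q
    refine exists_padicChar_eq ?_
    rw [← map_nsmul, nsmul_eq_mul, Nat.cast_pow, hpow]
  choose a ha using hex
  -- χ has p^n-torsion values, so it is x ↦ c_1(x w)/p^n for some w. As χ kills s, one has s w = p^n
  -- y; multiplying by t and cancelling p^n gives w = t y, and y represents χ.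
  let w : MonoidAlgebra ℤ_[p] (G ⧸ (U : Subgroup G)) := .ofCoeff (Finsupp.equivFunOnFinite.symm a)
  have hw : ∀ x, padicChar p (n U) ((proj p G U x * w).coeff 1) = χ x := by
    intro x
    obtain ⟨z, hz⟩ := exists_proj_ofGroupRing_eq p G U (proj p G U x)
    rw [← hproj _ _ hz, ← hz]
    clear hz
    induction z using MonoidAlgebra.induction_linear with
    | zero => simp
    | add x y hx hy => 
      simp only [map_add, add_mul]
      rw [← hx, ← hy, ← map_add]
      rfl
    | single g c =>
      obtain ⟨k, y, hc⟩ := exists_eq_natCast_add (n U) c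
      have h1 : proj p G U (ofGroupRing p G (MonoidAlgebra.single g c)) =
          MonoidAlgebra.single (g : G ⧸ (U : Subgroup G)) c := MonoidAlgebra.mapDomain_single
      have h2 : w.coeff (g : G ⧸ (U : Subgroup G))⁻¹ = a (g : G ⧸ (U : Subgroup G))⁻¹ := rfl
      have h3 : χ (groupElt p G (g : G ⧸ (U : Subgroup G)).out) = χ (groupElt p G g) := by
        refine hproj _ _ ?_
        rw [proj_groupElt, proj_groupElt]
        exact congrArg (fun q => MonoidAlgebra.single q (1 : ℤ_[p])) (Quotient.out_eq _)
      rw [h1, MonoidAlgebra.coeff_single_mul_apply, mul_one, h2, padicChar_mul _ _ _ hc, ha, inv_inv,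
        h3, ofGroupRing_single]
      have h4 : scalar p G c * groupElt p G g = k • groupElt p G g +
          (p : CompletedGroupAlgebra p G) ^ n U * (scalar p G y * groupElt p G g) := by
        rw [hc, map_add, map_mul, map_pow, map_natCast, map_natCast, add_mul, mul_assoc, nsmul_eq_mul]
      rw [h4, map_add, hpow, add_zero, map_nsmul]
  have hdvd : ∀ q, (p : ℤ_[p]) ^ n U ∣ (proj p G U s * w).coeff q := by
    intro q
    obtain ⟨x, hx⟩ := proj_surjective p G U (MonoidAlgebra.single q⁻¹ 1)
    rw [← padicChar_eq_zero_iff, ← coeff_single_mul_one, ← hx, ← mul_assoc, ← map_mul, hw, mul_comm, hs]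
  obtain ⟨y, hy⟩ := exists_eq_natCast_pow_mul hdvd
  obtain ⟨y, rfl⟩ := proj_surjective p G U y
  have hty : w = t U * proj p G U y := by
    refine natCast_pow_mul_cancel (n := n U) ?_
    rw [mul_left_comm, ← hy, ← mul_assoc, ht]
  refine ⟨y, fun x => ?_⟩
  rw [levelChar_apply, map_mul, mul_left_comm, ← hty, hw]

/-- Solutions at a single level form a nonempty closed set, and norm compatibility shrinks these
sets as U shrinks. Compactness of ℤ_p⟦G⟧ gives a common solution. -/
theorem exists_forall_levelChar_mul_eq [IsNoetherianRing (CompletedGroupAlgebra p G)]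
    (χ : OpenSubgroup G → CompletedGroupAlgebra p G →+ AddCircle (1 : ℚ))
    (hU : ∀ U, ∀ x ∈ augIdeal p U, χ U x = 0) (hs : ∀ U x, χ U (s * x) = 0)
    (hN : ∀ U V, V ≤ U → ∀ x, χ V (normElt p U V * x) = χ U x) :
    ∃ y, ∀ U x, levelChar n t U (x * y) = χ U x := by
  let Y : OpenSubgroup G → Set (CompletedGroupAlgebra p G) := fun U =>
    {y | ∀ x, levelChar n t U (x * y) = χ U x}
  have hanti : ∀ U V, V ≤ U → Y V ⊆ Y U := by
    intro U V h y hy x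
    rw [← hN U V h, ← hy, mul_assoc, levelChar_normElt_mul ht h]
  have hcl : ∀ U, IsClosed (Y U) := by
    intro U
    have : Y U = ⋂ x, (fun y => levelChar n t U (x * y)) ⁻¹' {χ U x} := by
      ext y
      simp [Y]
    rw [this]
    exact isClosed_iInter fun x =>
      ((isLocallyConstant_levelChar U).comp_continuous (continuous_const_mul x)).isClosed_fiber _
  obtain ⟨y, hy⟩ := IsCompact.nonempty_iInter_of_directed_nonempty_isCompact_isClosed Y
    (fun U V => ⟨U ⊓ V, hanti _ _ inf_le_left, hanti _ _ inf_le_right⟩)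
    (fun U => exists_levelChar_mul_eq ht U (χ U) (hU U) (hs U)) (fun U => (hcl U).isCompact) hcl
  exact ⟨y, fun U => Set.mem_iInter.1 hy U⟩

variable {M : Type*} [AddCommGroup M] [Module (CompletedGroupAlgebra p G) M]

theorem exists_character_of_hom (h : M →ₗ[CompletedGroupAlgebra p G] _ ⧸ Ideal.span {s}) :
    ∃ ξ : CharacterModule (CoinvariantsLimit (G := G) p M),
      ∀ U m y, h m = Ideal.Quotient.mk _ y → ξ (toLimit U m) = levelChar n t U y := by
  let σ := Function.surjInv (Ideal.Quotient.mk_surjective (I := Ideal.span {s}))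
  have hσ : ∀ q, Ideal.Quotient.mk _ (σ q) = q := Function.surjInv_eq _
  let χ : OpenSubgroup G → CharacterModule M := fun U =>
    AddMonoidHom.mk' (fun m => levelChar n t U (σ (h m))) fun m m' => by
      rw [← map_add]
      refine levelChar_eq_of_mk_eq ht U ?_
      rw [hσ, map_add, map_add, hσ, hσ]
  have hχ : ∀ U m y, h m = Ideal.Quotient.mk _ y → χ U m = levelChar n t U y := fun U m y hy =>
    levelChar_eq_of_mk_eq ht U ((hσ _).trans hy)
  have hsmul : ∀ (a : CompletedGroupAlgebra p G) m,
      h (a • m) = Ideal.Quotient.mk _ (a * σ (h m)) := by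
    intro a m
    rw [map_smul, map_mul, hσ]
    rfl
  obtain ⟨ξ, hξ⟩ := exists_character_limit (p := p) χ (fun U m hm => by
      rw [coinvariantsKer_eq] at hm
      refine Submodule.smul_induction_on hm (fun a ha m _ => ?_) fun m m' h1 h2 => ?_
      · rw [hχ U _ _ (hsmul a m)]
        exact levelChar_eq_zero_of_mem_augIdeal (Ideal.mul_mem_right _ _ ha)
      · rw [map_add, h1, h2, add_zero])
    (fun U V hVU m => by
      rw [hχ V _ _ (hsmul _ m), levelChar_normElt_mul ht hVU, hχ U _ _ (hσ _).symm])
  exact ⟨ξ, fun U m y hy => (hξ U m).trans (hχ U m y hy)⟩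

/-- For each m the characters x ↦ ξ(x m) of the levels are represented by one y, unique modulo s by
perfectness. Uniqueness makes m ↦ y mod s linear. -/
theorem exists_hom_of_character [IsNoetherianRing (CompletedGroupAlgebra p G)]
    (hs : ∀ m : M, s • m = 0) (ξ : CharacterModule (CoinvariantsLimit (G := G) p M)) :
    ∃ h : M →ₗ[CompletedGroupAlgebra p G] _ ⧸ Ideal.span {s},
      ∀ U m y, h m = Ideal.Quotient.mk _ y → ξ (toLimit U m) = levelChar n t U y := by
  have key : ∀ m : M, ∃ y, ∀ U x, levelChar n t U (x * y) = ξ (toLimit U (x • m)) := by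
    intro m
    refine exists_forall_levelChar_mul_eq ht (fun U => AddMonoidHom.comp (ξ : _ →+ AddCircle (1 : ℚ))
      ((toLimit U).comp (LinearMap.toSpanSingleton _ M m)).toAddMonoidHom) ?_ ?_ ?_
    · intro U x hx
      change ξ (toLimit U (x • m)) = 0
      rw [toLimit_eq_zero_of_mem, map_zero]
      rw [coinvariantsKer_eq]
      exact Submodule.smul_mem_smul hx trivial
    · intro U x
      change ξ (toLimit U ((s * x) • m)) = 0
      rw [mul_smul, hs, map_zero, map_zero]
    · intro U V h x
      change ξ (toLimit V ((normElt p U V * x) • m)) = ξ (toLimit U (x • m))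
      rw [mul_smul, toLimit_normElt_smul h]
  choose y hy using key
  have huniq : ∀ m z, (∀ U x, levelChar n t U (x * z) = ξ (toLimit U (x • m))) →
      Ideal.Quotient.mk (Ideal.span {s}) (y m) = Ideal.Quotient.mk _ z := by
    intro m z hz
    refine Ideal.Quotient.eq.2 (mem_span_of_levelChar_eq_zero ht fun U x => ?_)
    rw [mul_sub, map_sub, hy, hz, sub_self]
  refine ⟨{ toFun m := Ideal.Quotient.mk _ (y m)
            map_add' m m' := by
              rw [← map_add]
              refine huniq _ _ fun U x => ?_
              rw [mul_add, map_add, hy, hy, smul_add, map_add, map_add]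
            map_smul' a m := by
              change _ = Ideal.Quotient.mk _ (a * y m)
              refine huniq _ _ fun U x => ?_
              rw [← mul_assoc, hy, mul_smul] }, fun U m z hz => ?_⟩
  rw [← levelChar_eq_of_mk_eq ht U hz]
  have := hy m U 1
  rw [one_mul, one_smul] at this
  exact this.symm

/-- For `s` killing `M` and nonsingular at every finite level, the dual of `lim M_U` is
`Hom(M, ℤ_p⟦G⟧/s)`. -/
theorem nonempty_hom_linearEquiv_character [IsNoetherianRing (CompletedGroupAlgebra p G)]
    (hs : ∀ m : M, s • m = 0) :
    Nonempty ((M →ₗ[CompletedGroupAlgebra p G] _ ⧸ Ideal.span {s}) ≃ₗ[CompletedGroupAlgebra p G]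
      CharacterModule (CoinvariantsLimit (G := G) p M)) := by
  choose Φ hΦ using exists_character_of_hom (M := M) ht
  have huniq : ∀ h ξ, (∀ U m y, h m = Ideal.Quotient.mk _ y → ξ (toLimit U m) = levelChar n t U y) →
      Φ h = ξ := by
    intro h ξ hξ
    refine DFunLike.ext _ _ fun z => ?_
    obtain ⟨U, m, rfl⟩ := exists_toLimit_eq z
    obtain ⟨y, hy⟩ := Ideal.Quotient.mk_surjective (h m)
    rw [hΦ h U m y hy.symm, hξ U m y hy.symm]
  let L : (M →ₗ[CompletedGroupAlgebra p G] _ ⧸ Ideal.span {s}) →ₗ[CompletedGroupAlgebra p G]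
      CharacterModule (CoinvariantsLimit (G := G) p M) :=
    { toFun := Φ
      map_add' h h' := by
        refine huniq _ _ fun U m y hy => ?_
        obtain ⟨z, hz⟩ := Ideal.Quotient.mk_surjective (h m)
        obtain ⟨z', hz'⟩ := Ideal.Quotient.mk_surjective (h' m)
        rw [LinearMap.add_apply, ← hz, ← hz', ← map_add] at hy
        rw [← levelChar_eq_of_mk_eq ht U hy, map_add, ← hΦ h U m z hz.symm, ← hΦ h' U m z' hz'.symm]
        rfl
      map_smul' a h := by
        refine huniq _ _ fun U m y hy => ?_
        rw [LinearMap.smul_apply, ← map_smul] at hy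
        change Φ h (a • toLimit U m) = _
        rw [← map_smul, hΦ h U _ y hy] }
  refine ⟨LinearEquiv.ofBijective L ⟨?_, fun ξ => ?_⟩⟩
  · refine (injective_iff_map_eq_zero L).2 fun h h0 => LinearMap.ext fun m => ?_
    obtain ⟨y, hy⟩ := Ideal.Quotient.mk_surjective (h m)
    rw [← hy, LinearMap.zero_apply, Ideal.Quotient.eq_zero_iff_mem]
    refine mem_span_of_levelChar_eq_zero ht fun U x => ?_
    have h1 : h (x • m) = Ideal.Quotient.mk _ (x * y) := by
      rw [map_smul, ← hy]
      rfl
    rw [← hΦ h U _ _ h1]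
    exact DFunLike.congr_fun h0 _
  · obtain ⟨h, hh⟩ := exists_hom_of_character ht hs ξ
    exact ⟨h, huniq h ξ hh⟩

end

end Duality

end Iwasawa

end


noncomputable section

namespace Iwasawa

/-! ### Pseudo-isomorphisms of twisted modules -/

section TwistedPseudoIso

theorem isPseudoNull_of_forall_exists {A K : Type*} [CommRing A] [AddCommGroup K] [Module A K]
    [Module.Finite A K]
    (h : ∀ P : Ideal A, P.IsPrime → P.height ≤ 1 → ∀ k : K, ∃ t ∉ P, t • k = 0) :
    IsPseudoNull A K :=
  ⟨inferInstance, fun P hP hP1 => LocalizedModule.subsingleton_iff.2 fun k => h P hP hP1 k⟩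

set_option linter.unusedSectionVars false

variable {p : ℕ} [Fact p.Prime] {G : Type*} [CommGroup G] [TopologicalSpace G]

theorem involution_involution (x : CompletedGroupAlgebra p G) :
    involution p G (involution p G x) = x := by
  refine Subtype.ext (funext fun U => ?_)
  change MonoidAlgebra.mapDomainRingHom ℤ_[p] _ (MonoidAlgebra.mapDomainRingHom ℤ_[p] _ _) = _
  rw [← RingHom.comp_apply, ← MonoidAlgebra.mapDomainRingHom_comp]
  have : (invMonoidHom : (G ⧸ (U : Subgroup G)) →* _).comp invMonoidHom = MonoidHom.id _ := by
    ext
    simp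
  rw [this, MonoidAlgebra.mapDomainRingHom_id]
  rfl

variable (p G) in
/-- The involution, as an automorphism. -/
def involutionEquiv : CompletedGroupAlgebra p G ≃+* CompletedGroupAlgebra p G :=
  RingEquiv.ofRingHom (involution p G) (involution p G)
    (RingHom.ext involution_involution) (RingHom.ext involution_involution)

variable {M N : Type*} [AddCommGroup M] [Module (CompletedGroupAlgebra p G) M]
  [AddCommGroup N] [Module (CompletedGroupAlgebra p G) N]

instance [Module.Finite (CompletedGroupAlgebra p G) M] :
    Module.Finite (CompletedGroupAlgebra p G) (Twist p G M) := by
  have : RingHomSurjective (involution p G) := ⟨(involutionEquiv p G).surjective⟩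
  let f : M →ₛₗ[involution p G] Twist p G M :=
    { toTwist p G M with
      map_smul' a m := by
        change toTwist p G M (a • m) = _ • toTwist p G M m
        rw [smul_toTwist, involution_involution] }
  exact Module.Finite.of_surjective f (toTwist p G M).surjective

/-- A homomorphism, viewed as a homomorphism of the twisted modules. -/
def twistMap (f : M →ₗ[CompletedGroupAlgebra p G] N) :
    Twist p G M →ₗ[CompletedGroupAlgebra p G] Twist p G N where
  toFun m := toTwist p G N (f ((toTwist p G M).symm m))
  map_add' m m' := by simp only [map_add]
  map_smul' a m := f.map_smul (involution p G a) _

/-- The condition at P for the twisted map is the condition for f at the pullback of P under the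
involution, a prime of the same height. -/
theorem isPseudoIso_twistMap [IsNoetherianRing (CompletedGroupAlgebra p G)]
    [Module.Finite (CompletedGroupAlgebra p G) M] [Module.Finite (CompletedGroupAlgebra p G) N]
    (f : M →ₗ[CompletedGroupAlgebra p G] N)
    (h : ∀ P : Ideal (CompletedGroupAlgebra p G), P.IsPrime → P.height ≤ 1 →
      (∀ x, f x = 0 → ∃ t ∉ P, t • x = 0) ∧ ∀ y, ∃ t ∉ P, ∃ x, f x = t • y) :
    IsPseudoIso (twistMap f) := by
  have h' : ∀ P : Ideal (CompletedGroupAlgebra p G), P.IsPrime → P.height ≤ 1 →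
      (∀ x, f x = 0 → ∃ t ∉ P, involution p G t • x = 0) ∧
        ∀ y, ∃ t ∉ P, ∃ x, f x = involution p G t • y := by
    intro P hP hP1
    have hι : ∀ t ∉ P.comap (involutionEquiv p G), involution p G t ∉ P := fun t ht => ht
    have h1 := h (P.comap (involutionEquiv p G)) inferInstance
      ((RingEquiv.height_comap (involutionEquiv p G) P).trans_le hP1)
    refine ⟨fun x hx => ?_, fun y => ?_⟩
    · obtain ⟨t, ht, htx⟩ := h1.1 x hx
      exact ⟨_, hι t ht, by rwa [involution_involution]⟩
    · obtain ⟨t, ht, x, hx⟩ := h1.2 y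
      exact ⟨_, hι t ht, x, by rwa [involution_involution]⟩
  refine ⟨isPseudoNull_of_forall_exists fun P hP hP1 => ?_,
    isPseudoNull_of_forall_exists fun P hP hP1 => ?_⟩
  · rintro ⟨x, hx⟩
    obtain ⟨t, ht, htx⟩ := (h' P hP hP1).1 x hx
    exact ⟨t, ht, Subtype.ext htx⟩
  · intro y
    obtain ⟨y, rfl⟩ := Submodule.Quotient.mk_surjective _ y
    obtain ⟨t, ht, x, hx⟩ := (h' P hP hP1).2 y
    exact ⟨t, ht, (Submodule.Quotient.mk_eq_zero _).2 ⟨x, hx⟩⟩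

end TwistedPseudoIso

/-- Open subgroups are clopen, and a second countable profinite space has countably many clopen
sets. Countability is what the Baire argument for s requires. -/
theorem countable_openSubgroup {d p : ℕ} [Fact p.Prime] {G : Type*} [CommGroup G]
    [TopologicalSpace G] [IsTopologicalGroup G] [CompactSpace G]
    (e : G ≃ₜ* Multiplicative (Fin d → ℤ_[p])) : Countable (OpenSubgroup G) := by
  let e' : G ≃ₜ (Fin d → ℤ_[p]) :=
    e.toHomeomorph.trans (Multiplicative.toAdd.toHomeomorph fun _ => Iff.rfl)
  have : SecondCountableTopology G := e'.secondCountableTopology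
  have : T2Space G := e'.symm.t2Space
  have : TotallyDisconnectedSpace G := e'.symm.totallyDisconnectedSpace
  have : Countable (TopologicalSpace.Clopens G) :=
    TopologicalSpace.Clopens.countable_iff_secondCountable.2 inferInstance
  let f : OpenSubgroup G → TopologicalSpace.Clopens G := fun U => ⟨U, U.isClopen⟩
  exact Function.Injective.countable (f := f) fun U V h =>
    SetLike.coe_injective (congrArg (fun C : TopologicalSpace.Clopens G => (C : Set G)) h)

end Iwasawa

end

/-! ### Assembly of the pseudo-isomorphism -/

theorem mainTheorem5 (p : ℕ) [Fact p.Prime] (d : ℕ) (hd : 1 ≤ d)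
    (G : Type*) [CommGroup G] [TopologicalSpace G] [IsTopologicalGroup G] [CompactSpace G]
    (e : G ≃ₜ* Multiplicative (Fin d → ℤ_[p]))
    (M : Type*) [AddCommGroup M] [Module (Iwasawa.CompletedGroupAlgebra p G) M]
    (hM : Module.Finite (Iwasawa.CompletedGroupAlgebra p G) M ∨ Iwasawa.IsProfiniteModule p G M)
    (hfin : Iwasawa.SystematicallyCoinvariantFinite (G := G) p M) :
    ∃ f : Iwasawa.Twist p G M →ₗ[Iwasawa.CompletedGroupAlgebra p G]
        Iwasawa.PontryaginDual p G (Iwasawa.CoinvariantsLimit (G := G) p M),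
      Iwasawa.IsPseudoIso f := by
  have := Iwasawa.isNoetherianRing_completedGroupAlgebra e
  have := Iwasawa.isDomain_completedGroupAlgebra e
  have := Iwasawa.isIntegrallyClosed_completedGroupAlgebra e
  have := Iwasawa.countable_openSubgroup e
  have : Module.Finite (Iwasawa.CompletedGroupAlgebra p G) M := by
    rcases hM with hM | hM
    · exact hM
    · have := hfin ⊤
      exact hM.finite (Iwasawa.exists_pow_mem e) ⊤
  obtain ⟨s, hs, ht⟩ := Iwasawa.exists_annihilator_forall_dvd_pow hfin
  choose t n ht using ht
  -- If s were 0, a power of p would vanish in ℤ_p[G/U] at the level U = G.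
  have hs0 : s ≠ 0 := by
    rintro rfl
    have h1 := ht ⊤
    rw [map_zero, mul_zero] at h1
    have h2 := Iwasawa.natCast_pow_mul_cancel (p := p) (n := n ⊤)
      (H := G ⧸ ((⊤ : OpenSubgroup G) : Subgroup G)) (x := 1) (y := 0) (by rw [mul_one, mul_zero, h1])
    exact one_ne_zero h2
  obtain ⟨f, hf⟩ := Iwasawa.exists_hom_quotient_pseudoIso hs0 hs
  obtain ⟨Φ⟩ := Iwasawa.nonempty_hom_linearEquiv_character ht hs
  have : Module.Finite (Iwasawa.CompletedGroupAlgebra p G)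
    (CharacterModule (Iwasawa.CoinvariantsLimit (G := G) p M)) := Module.Finite.equiv Φ
  refine ⟨Iwasawa.twistMap (Φ.toLinearMap.comp f), Iwasawa.isPseudoIso_twistMap _
    fun P hP hP1 => ⟨fun x hx => ?_, fun y => ?_⟩⟩
  · exact (hf P hP hP1).1 x (Φ.map_eq_zero_iff.1 hx)
  · obtain ⟨u, hu, x, hx⟩ := (hf P hP hP1).2 (Φ.symm y)
    refine ⟨u, hu, x, ?_⟩
    rw [LinearMap.comp_apply, hx, map_smul]
    exact congrArg _ (Φ.apply_symm_apply y)
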